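/- Let $((A_j)_{j\ge1},B)$ be a random sequence with values in $[0,\infty)$ and $\mathbb P(B=0)<1$. Let $((A_{t,j})_{j\ge1},B_t)_{t\in\mathbb Z}$ be non-negative random variables satisfying one of the following: (A1) $((A_{t,j})_{j\ge1},B_t)_{t\in\mathbb Z}$ are iid copies of $((A_j)_{j\ge1},B)$; or (A2) $A_{t,j}=A'_{t-j,j}$ for all $t\in\mathbb Z$, $j\ge1$, where $((A'_{t,j})_{j\ge1})_{t\in\mathbb Z}$ are iid copies of $(A_j)_{j\ge1}$, and $(B_t)_{t\in\mathbb Z}$ are iid copies of $B$, independent of the family $(A_{t,j})_{t\in\mathbb Z,\,j\ge1}$. Let $X_t=\sum_{j\ge1}A_{t,j}X_{t-j}+B_t$ for $t\ge0$, with $X_t=0$ for $t<0$. Let $\mathscr T$ be the set of finite integer sequences $\boldsymbol t=(t_0,\dots,t_n)$, $n=n(\boldsymbol t)\ge0$, with $0=t_0<t_1<\dots<t_n$; put $\tilde A_{\boldsymbol t}=\prod_{i=0}^{n-1}A_{-t_i,\,t_{i+1}-t_i}$ (equal to $1$ if $n=0$). Let $\mathscr C$ be the set of closed pairs, that is, of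 pairs $(\boldsymbol s,\boldsymbol t)\in\mathscr T^2$ with $n(\boldsymbol s),n(\boldsymbol t)>0$, $s_{n(\boldsymbol s)}=t_{n(\boldsymbol t)}$, and $s_i\ne t_j$ whenever $0<i<n(\boldsymbol s)$ and $0<j<n(\boldsymbol t)$. For $\theta>0$ define, with values in $[-\infty,\infty]$, $$\phi_1(\theta)=\log\sum_{j\ge1}\mathbb E[A_j^\theta],\qquad \tilde\phi_1(\theta)=\log\sum_{j\ge1}\mathbb E[A_j^\theta]^{1/\theta},$$ $$\phi_2(\theta)=\log\sum_{(\boldsymbol s,\boldsymbol t)\in\mathscr C}\mathbb E[\tilde A_{\boldsymbol s}^{\theta/2}\tilde A_{\boldsymbol t}^{\theta/2}],\qquad \tilde\phi_2(\theta)=\log\sum_{(\boldsymbol s,\boldsymbol t)\in\mathscr C}\mathbb E[\tilde A_{\boldsymbol s}^{\theta/2}\tilde A_{\boldsymbol t}^{\theta/2}]^{2/\theta}.$$ Then $X_t$ converges in law, as $t\to\infty$, to a limit $X$ with values in $[0,\infty]$, and the following hold for every $\theta>0$. 1. If either $\theta\ge2$ and $\phi_2(\theta)\ge0$, or $\theta\le2$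 and $\tilde\phi_2(\theta)\ge0$, then $\mathbb E[X^\theta]=\infty$. 2. Assume that (a) either $\theta\le2$, $\phi_1(\theta/2)<0$ and $\phi_2(\theta)<0$, or $\theta\ge2$, $\tilde\phi_1(\theta/2)<0$ and $\tilde\phi_2(\theta)<0$; (b) $\sum_{i,j\ge1}\mathbb E[A_i^{\theta/2}A_j^{\theta/2}]^{\min(1,2/\theta)}<\infty$ (required only under (A1), not under (A2)); (c) $\mathbb E[B^\theta]<\infty$. Then $\mathbb E[X^\theta]<\infty$. 3. In particular, if (b) and (c) hold for $\theta=2$ ((b) being required only under (A1)), then $\mathbb E[X^2]<\infty$ if and only if $\phi_1(1)<0$ and $\phi_2(2)<0$. -/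

import Mathlib

open MeasureTheory ProbabilityTheory Filter Topology
open scoped NNReal ENNReal

namespace RandomCoeffAR

noncomputable section

/-- The solution started from zero of the recursion
`X_t = ∑_{j ≥ 1} a_{t,j} X_{t-j} + b_t` for `t ≥ 0`, with `X_t = 0` for `t < 0`.
Terms with `t - j < 0` therefore vanish. -/
def arSol (a : ℤ → ℕ+ → ℝ≥0) (b : ℤ → ℝ≥0) (t : ℕ) : ℝ≥0∞ :=
  (∑' j : ℕ+, if (j : ℕ) ≤ t then (a t j : ℝ≥0∞) * arSol a b (t - (j : ℕ)) else 0) + b t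
termination_by t
decreasing_by
  have := j.pos
  omega

section Model

variable {Ω₀ Ω : Type*} [MeasurableSpace Ω₀] [MeasurableSpace Ω]

/-- Assumption (A1): the pairs `((A_{t,j})_{j ≥ 1}, B_t)`, `t ∈ ℤ`, are iid copies of
`((A_j)_{j ≥ 1}, B)`. The coefficients `A_j` and `B` may be dependent. -/
structure AssumptionA1 (P₀ : Measure Ω₀) (A₀ : ℕ+ → Ω₀ → ℝ≥0) (B₀ : Ω₀ → ℝ≥0)
    (P : Measure Ω) (A : ℤ → ℕ+ → Ω → ℝ≥0) (B : ℤ → Ω → ℝ≥0) : Prop where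
  indep : iIndepFun (fun (t : ℤ) (ω : Ω) => ((fun j : ℕ+ => A t j ω), B t ω)) P
  copies : ∀ t : ℤ, IdentDistrib (fun ω : Ω => ((fun j : ℕ+ => A t j ω), B t ω))
    (fun ω : Ω₀ => ((fun j : ℕ+ => A₀ j ω), B₀ ω)) P P₀

/-- Assumption (A2): `A_{t,j} = A'_{t-j,j}` where the sequences `(A'_{t,j})_{j ≥ 1}`, `t ∈ ℤ`,
are iid copies of `(A_j)_{j ≥ 1}`, and the `B_t`, `t ∈ ℤ`, are iid copies of `B`, independent of
the whole family of coefficients. -/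
structure AssumptionA2 (P₀ : Measure Ω₀) (A₀ : ℕ+ → Ω₀ → ℝ≥0) (B₀ : Ω₀ → ℝ≥0)
    (P : Measure Ω) (A : ℤ → ℕ+ → Ω → ℝ≥0) (B : ℤ → Ω → ℝ≥0) : Prop where
  coeff : ∃ A' : ℤ → ℕ+ → Ω → ℝ≥0,
    (∀ (t : ℤ) (j : ℕ+) (ω : Ω), A t j ω = A' (t - (j : ℤ)) j ω) ∧
    iIndepFun (fun (t : ℤ) (ω : Ω) (j : ℕ+) => A' t j ω) P ∧
    ∀ t : ℤ, IdentDistrib (fun (ω : Ω) (j : ℕ+) => A' t j ω)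
      (fun (ω : Ω₀) (j : ℕ+) => A₀ j ω) P P₀
  noise_indep : iIndepFun B P
  noise_copies : ∀ t : ℤ, IdentDistrib (B t) B₀ P P₀
  noise_coeff_indep :
    IndepFun (fun (ω : Ω) (t : ℤ) => B t ω) (fun (ω : Ω) (t : ℤ) (j : ℕ+) => A t j ω) P

end Model

/-- A finite sequence `0 = t_0 < t_1 < ⋯ < t_n` of integers (`n ≥ 0`), encoded by the list of its
jumps `t_1 - t_0, …, t_n - t_{n-1}`; thus `n` is the length of the list, the empty list is the
trivial sequence `(0)`, and `time` recovers the entries `t_k`. -/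
abbrev Path : Type := List ℕ+

/-- The entry `t_k` of a path, for `k ≤ n`. -/
def Path.time (s : Path) (k : ℕ) : ℕ := ((s.take k).map (fun j : ℕ+ => (j : ℕ))).sum

theorem Path.time_succ (s : Path) (k : ℕ) (hk : k < s.length) :
    Path.time s (k + 1) = Path.time s k + (s[k] : ℕ) := by
  unfold Path.time
  rw [List.take_add_one, List.map_append, List.sum_append, List.getElem?_eq_getElem hk]
  rfl

/-- Jump lists are in bijection with increasing sequences starting at zero. -/
theorem Path.existsUnique_time_eq (n : ℕ) (t : ℕ → ℕ) (h0 : t 0 = 0)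
    (ht : ∀ k < n, t k < t (k + 1)) :
    ∃! s : Path, s.length = n ∧ ∀ k ≤ n, Path.time s k = t k := by
  have hj : ∀ k, ∃ j : ℕ+, k < n → t (k + 1) = t k + j := by
    intro k
    by_cases hk : k < n
    · have := ht k hk
      refine ⟨⟨t (k + 1) - t k, by omega⟩, fun _ => ?_⟩
      simp only [PNat.mk_coe]
      omega
    · exact ⟨1, fun h => absurd h hk⟩
  choose j hj using hj
  refine ⟨List.ofFn (fun k : Fin n => j k), ⟨by simp, ?_⟩, ?_⟩
  · intro k hk
    induction k with
    | zero => simp [Path.time, h0]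
    | succ k ih =>
      rw [Path.time_succ _ _ (by simpa using hk), ih (by omega), hj k (by omega)]
      simp
  · rintro s ⟨hs, h⟩
    apply List.ext_getElem (by simp [hs])
    intro k hk _
    have h1 := h k (by omega)
    have h2 := h (k + 1) (by omega)
    rw [Path.time_succ _ _ hk, h1, hj k (by omega)] at h2
    apply PNat.eq
    simpa using h2

/-- The weight `Ã_{t} = ∏_{i < n} Ã_{t_i, t_{i+1} - t_i}` of a path, where `Ã_{t,j} = a_{-t,j}`;
the weight of the trivial path is `1`. -/
def Path.weight (a : ℤ → ℕ+ → ℝ≥0) (s : Path) : ℝ≥0 :=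
  ∏ i : Fin s.length, a (-(Path.time s i : ℤ)) (s.get i)

/-- The set of closed pairs: both paths are non-trivial, they have the same end point, and they
do not meet strictly between their start and their end. -/
def closedPairs : Set (Path × Path) :=
  {p | 0 < p.1.length ∧ 0 < p.2.length ∧
    Path.time p.1 p.1.length = Path.time p.2 p.2.length ∧
    ∀ i j : ℕ, 0 < i → i < p.1.length → 0 < j → j < p.2.length →
      Path.time p.1 i ≠ Path.time p.2 j}

section Functions

variable {Ω₀ Ω : Type*} [MeasurableSpace Ω₀] [MeasurableSpace Ω]

/-- `φ₁(θ) = log ∑_{j ≥ 1} E[A_j ^ θ]`, an extended real number. -/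
def phi₁ (P₀ : Measure Ω₀) (A₀ : ℕ+ → Ω₀ → ℝ≥0) (θ : ℝ) : EReal :=
  ENNReal.log (∑' j : ℕ+, ∫⁻ ω, (A₀ j ω : ℝ≥0∞) ^ θ ∂P₀)

/-- `φ̃₁(θ) = log ∑_{j ≥ 1} E[A_j ^ θ] ^ (1 / θ)`. -/
def phiTilde₁ (P₀ : Measure Ω₀) (A₀ : ℕ+ → Ω₀ → ℝ≥0) (θ : ℝ) : EReal :=
  ENNReal.log (∑' j : ℕ+, (∫⁻ ω, (A₀ j ω : ℝ≥0∞) ^ θ ∂P₀) ^ (1 / θ))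

/-- `E[Ã_s ^ (θ/2) * Ã_t ^ (θ/2)]` for a pair of paths. -/
def pairMoment (P : Measure Ω) (A : ℤ → ℕ+ → Ω → ℝ≥0) (θ : ℝ) (p : Path × Path) : ℝ≥0∞ :=
  ∫⁻ ω, (Path.weight (fun t j => A t j ω) p.1 : ℝ≥0∞) ^ (θ / 2) *
    (Path.weight (fun t j => A t j ω) p.2 : ℝ≥0∞) ^ (θ / 2) ∂P

/-- `φ₂(θ) = log ∑ E[Ã_s ^ (θ/2) * Ã_t ^ (θ/2)]`, the sum over the closed pairs. -/
def phi₂ (P : Measure Ω) (A : ℤ → ℕ+ → Ω → ℝ≥0) (θ : ℝ) : EReal :=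
  ENNReal.log (∑' p : closedPairs, pairMoment P A θ p)

/-- `φ̃₂(θ) = log ∑ E[Ã_s ^ (θ/2) * Ã_t ^ (θ/2)] ^ (2 / θ)`, the sum over the closed pairs. -/
def phiTilde₂ (P : Measure Ω) (A : ℤ → ℕ+ → Ω → ℝ≥0) (θ : ℝ) : EReal :=
  ENNReal.log (∑' p : closedPairs, pairMoment P A θ p ^ (2 / θ))

/-- `∑_{i,j ≥ 1} E[A_i ^ (θ/2) * A_j ^ (θ/2)] ^ min(1, 2/θ) < ∞`. -/
def MixedMomentSummable (P₀ : Measure Ω₀) (A₀ : ℕ+ → Ω₀ → ℝ≥0) (θ : ℝ) : Prop :=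
  ∑' (i : ℕ+) (j : ℕ+),
    (∫⁻ ω, (A₀ i ω : ℝ≥0∞) ^ (θ / 2) * (A₀ j ω : ℝ≥0∞) ^ (θ / 2) ∂P₀) ^ (min 1 (2 / θ)) < ∞

end Functions

end

end RandomCoeffAR

/-!
The solution at time `t` is the sum over all backward paths `t = t_0 > t_1 > ⋯ > t_n ≥ 0` of the
product of the coefficients along the path and the noise at its end (`arSol_eq_tsum_pathTerm`). Its
square is therefore a sum over pairs of paths with a common start, and such a pair can be cut at
the first time at which the two paths meet again. The part before this time is a closed pair, the
part after it is an arbitrary pair started from the meeting time, and the two parts use independent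
coefficients. Hence the moments of the solution satisfy renewal inequalities, with the closed pairs
as the possible jumps of the renewal process.

*Two models, one structure.* `IsIndexed` records what both models provide: independent σ-algebras
such that each coefficient and each noise variable is measurable with respect to one of them, plus
invariance in law under time shifts. A coefficient is indexed by the start of its jump if the pairs
of coefficient sequence and noise are iid, and by the end of its jump in the model with shifted
coefficients. In either case distinct jumps can share an index only by sharing their start or their
end, which is all that the independence arguments need. Invariance under shifts also
turns the solution into a pathwise monotone sequence, by starting the recursion at time `-t` and
evaluating it at time zero; this gives the limit law, and its moments are the suprema of the
moments of the solution (`IsIndexed.lintegral_limit`).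

*Subadditivity.* For `q = θ / 2`, the functional `E[Z ^ q] ^ min(1, 1/q)` is countably subadditive
and `E[Z ^ q] ^ max(1, 1/q)` is superadditive (`lintegral_tsum_rpow_le`, `tsum_lintegral_rpow_le`).
Applied to the expansion of the square of the solution they turn pointwise estimates into
inequalities between moments of order `θ`.

*Infinite moments.* The pair of trivial paths and the pairs that begin with a closed pair give a
lower bound on the square, hence a renewal inequality whose weights have total mass at least one;
its supremum is infinite (`iSup_eq_top_of_renewal_le`). The same lemma, applied to the mean of the
solution, shows that a finite mean forces `∑ E[A_j] < 1`.

*Finite moments.* For the upper bound one has to add the pairs of which one path is trivial, and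
those that never meet again. The latter contribute a finite amount, since all their jumps except
the two first ones are independent (`IsIndexed.lintegral_avoidTerm_le`). The former are products of
the noise `b` and the remainder `y` of the solution, which may be dependent and whose direct
expansion need not be summable when `θ > 2`; they are removed by `(y + b)² ≤ c y² + C b²` with `c`
so close to one that the weights of the closed pairs, multiplied by the resulting power of `c`,
still have total mass less than one. A solution of the resulting renewal inequality is bounded
(`iSup_lt_top_of_le_renewal`).
-/

namespace RandomCoeffAR

noncomputable section

/-! ### Paths, their durations and weights -/

/-- The last entry `t_n` of a path. -/
def Path.duration (s : Path) : ℕ := (s.map (fun j : ℕ+ => (j : ℕ))).sum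

@[simp] theorem Path.duration_nil : Path.duration [] = 0 := rfl

@[simp] theorem Path.duration_cons (j : ℕ+) (s : Path) :
    Path.duration (j :: s) = j + Path.duration s := by
  simp [Path.duration]

theorem Path.duration_append (s u : Path) :
    Path.duration (s ++ u) = Path.duration s + Path.duration u := by
  simp [Path.duration]

theorem Path.duration_pos {s : Path} (hs : s ≠ []) : 0 < Path.duration s := by
  cases s with
  | nil => exact absurd rfl hs
  | cons j s =>
    have := j.pos
    rw [Path.duration_cons]
    omega

theorem Path.time_length (s : Path) : Path.time s s.length = Path.duration s := by
  simp [Path.time, Path.duration]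

@[simp] theorem Path.time_zero (s : Path) : Path.time s 0 = 0 := by simp [Path.time]

@[simp] theorem Path.time_cons_succ (j : ℕ+) (s : Path) (k : ℕ) :
    Path.time (j :: s) (k + 1) = j + Path.time s k := by
  simp [Path.time]

theorem Path.time_append_left (s u : Path) {k : ℕ} (hk : k ≤ s.length) :
    Path.time (s ++ u) k = Path.time s k := by
  simp [Path.time, List.take_append_of_le_length hk]

/-- The weight of a path that starts at an arbitrary time `t` and runs backwards, in recursive
form: a jump `j` at time `t` costs `a t j` and leads to time `t - j`. -/
def Path.weightFrom (a : ℤ → ℕ+ → ℝ≥0) : ℤ → Path → ℝ≥0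
  | _, [] => 1
  | t, j :: s => a t j * Path.weightFrom a (t - (j : ℕ)) s

theorem Path.weight_cons (a : ℤ → ℕ+ → ℝ≥0) (j : ℕ+) (s : Path) :
    Path.weight a (j :: s) = a 0 j * Path.weight (fun u i => a (u - (j : ℕ)) i) s := by
  unfold Path.weight
  refine (Fin.prod_univ_succ (n := s.length) _).trans ?_
  congr 1
  refine Finset.prod_congr rfl fun i _ => ?_
  simp [sub_eq_add_neg, add_comm]

theorem Path.weight_shift (a : ℤ → ℕ+ → ℝ≥0) (t : ℤ) (s : Path) :
    Path.weight (fun u j => a (u + t) j) s = Path.weightFrom a t s := by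
  induction s generalizing t with
  | nil => simp [Path.weight, Path.weightFrom]
  | cons j s ih =>
    rw [Path.weight_cons, Path.weightFrom, ← ih (t - (j : ℕ))]
    simp only [zero_add]
    congr 2
    funext u i
    congr 1
    ring

theorem Path.weightFrom_append (a : ℤ → ℕ+ → ℝ≥0) (t : ℤ) (s u : Path) :
    Path.weightFrom a t (s ++ u)
      = Path.weightFrom a t s * Path.weightFrom a (t - Path.duration s) u := by
  induction s generalizing t with
  | nil => simp [Path.weightFrom]
  | cons j s ih =>
    rw [List.cons_append, Path.weightFrom, Path.weightFrom, ih, mul_assoc, Path.duration_cons]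
    push_cast
    rw [sub_sub]

/-! ### The path expansion of the solution -/

/-- The contribution of a path to the solution at time `t`: its weight, times the noise at its
end, provided that the path does not run below time zero. -/
def pathTerm (a : ℤ → ℕ+ → ℝ≥0) (b : ℤ → ℝ≥0) (t : ℕ) (s : Path) : ℝ≥0∞ :=
  if Path.duration s ≤ t then
    (Path.weightFrom a t s : ℝ≥0∞) * b ((t - Path.duration s : ℕ) : ℤ) else 0

@[simp] theorem pathTerm_nil (a : ℤ → ℕ+ → ℝ≥0) (b : ℤ → ℝ≥0) (t : ℕ) :
    pathTerm a b t [] = b t := by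
  simp [pathTerm, Path.weightFrom]

theorem pathTerm_append (a : ℤ → ℕ+ → ℝ≥0) (b : ℤ → ℝ≥0) (t : ℕ) (s u : Path) :
    pathTerm a b t (s ++ u) = if Path.duration s ≤ t then
      (Path.weightFrom a t s : ℝ≥0∞) * pathTerm a b (t - Path.duration s) u else 0 := by
  unfold pathTerm
  rw [Path.duration_append]
  by_cases h : Path.duration s ≤ t
  · rw [if_pos h]
    by_cases h' : Path.duration u ≤ t - Path.duration s
    · rw [if_pos h', if_pos (by omega), Path.weightFrom_append, ENNReal.coe_mul, mul_assoc,
        Nat.cast_sub h, Nat.sub_sub]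
    · rw [if_neg h', if_neg (by omega), mul_zero]
  · rw [if_neg h, if_neg (by omega)]

theorem tsum_list_eq {α : Type*} (f : List α → ℝ≥0∞) :
    ∑' s, f s = f [] + ∑' p : α × List α, f (p.1 :: p.2) := by
  let e : Unit ⊕ (α × List α) ≃ List α :=
    { toFun := Sum.elim (fun _ => []) (fun p => p.1 :: p.2)
      invFun := fun s => match s with
        | [] => Sum.inl ()
        | x :: s => Sum.inr (x, s)
      left_inv := by rintro (_ | ⟨x, s⟩) <;> rfl
      right_inv := by rintro (_ | ⟨x, s⟩) <;> rfl }
  rw [← e.tsum_eq, Summable.tsum_sum ENNReal.summable ENNReal.summable]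
  simp [e]

theorem arSol_eq_tsum_pathTerm (a : ℤ → ℕ+ → ℝ≥0) (b : ℤ → ℝ≥0) (t : ℕ) :
    arSol a b t = ∑' s : Path, pathTerm a b t s := by
  induction t using Nat.strong_induction_on with
  | _ t ih =>
    rw [arSol, tsum_list_eq, pathTerm_nil, add_comm, ENNReal.tsum_prod']
    congr 1
    refine tsum_congr fun j => ?_
    have key : ∀ s : Path, pathTerm a b t (j :: s)
        = if (j : ℕ) ≤ t then (a t j : ℝ≥0∞) * pathTerm a b (t - (j : ℕ)) s else 0 := by
      intro s
      have := pathTerm_append a b t [j] s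
      simpa [Path.weightFrom] using this
    simp_rw [key]
    by_cases h : (j : ℕ) ≤ t
    · have := j.pos
      simp only [if_pos h]
      rw [ih _ (by omega), ENNReal.tsum_mul_left]
    · simp [if_neg h]

/-- Starting the recursion one step earlier can only increase the solution. -/
theorem arSol_le_arSol_shift (a : ℤ → ℕ+ → ℝ≥0) (b : ℤ → ℝ≥0) (t : ℕ) :
    arSol a b t ≤ arSol (fun u j => a (u - 1) j) (fun u => b (u - 1)) (t + 1) := by
  induction t using Nat.strong_induction_on with
  | _ t ih =>
    rw [arSol, arSol]
    gcongr with j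
    · split_ifs with h h'
      · have := j.pos
        rw [show t + 1 - (j : ℕ) = t - j + 1 by omega]
        push_cast
        rw [add_sub_cancel_right]
        gcongr
        exact ih _ (by omega)
      · omega
      · exact zero_le
      · exact zero_le
    · simp

/-! ### Cutting pairs of paths at their first meeting point -/

/-- Two paths never meet after their common start. -/
def Path.Avoid (s u : Path) : Prop :=
  ∀ i k : ℕ, 0 < i → i ≤ s.length → 0 < k → k ≤ u.length → Path.time s i ≠ Path.time u k

theorem closedPairs.duration_eq {p : Path × Path} (hp : p ∈ closedPairs) :
    Path.duration p.1 = Path.duration p.2 := by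
  rw [← Path.time_length, ← Path.time_length]
  exact hp.2.2.1

theorem closedPairs.duration_pos {p : Path × Path} (hp : p ∈ closedPairs) :
    0 < Path.duration p.1 :=
  Path.duration_pos (List.ne_nil_of_length_pos hp.1)

theorem Path.exists_eq_append_of_duration_le {s s' u u' : Path} (h : s ++ u = s' ++ u')
    (hd : Path.duration s ≤ Path.duration s') : ∃ r, s' = s ++ r := by
  rcases List.append_eq_append_iff.1 h with ⟨r, hr, -⟩ | ⟨r, hr, -⟩
  · exact ⟨r, hr⟩
  · rcases eq_or_ne r [] with rfl | hne
    · exact ⟨[], by simpa using hr.symm⟩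
    · have := Path.duration_pos hne
      rw [hr, Path.duration_append] at hd
      omega

/-- A closed pair is determined by any pair of paths that it begins: it ends at their first
meeting point. -/
theorem closedPairs.append_injective :
    Function.Injective (fun x : closedPairs × (Path × Path) =>
      ((x.1 : Path × Path).1 ++ x.2.1, (x.1 : Path × Path).2 ++ x.2.2)) := by
  have main : ∀ {p p' : Path × Path}, p ∈ closedPairs → p' ∈ closedPairs →
      ∀ {u v u' v' : Path}, p.1 ++ u = p'.1 ++ u' → p.2 ++ v = p'.2 ++ v' →
      Path.duration p.1 ≤ Path.duration p'.1 → p = p' := by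
    rintro ⟨s, t⟩ ⟨s', t'⟩ hp hp' u v u' v' hu hv hd
    have e1 := closedPairs.duration_eq hp
    have e2 := closedPairs.duration_eq hp'
    obtain ⟨r, hr⟩ := Path.exists_eq_append_of_duration_le hu hd
    obtain ⟨r', hr'⟩ := Path.exists_eq_append_of_duration_le hv (by rw [← e1, ← e2]; exact hd)
    dsimp only at hr hr' e1 e2
    subst hr hr'
    rw [Path.duration_append, Path.duration_append] at e2
    rcases eq_or_ne r [] with rfl | hne
    · rcases eq_or_ne r' [] with rfl | hne'
      · simp
      · have := Path.duration_pos hne'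
        simp at e2
        omega
    · rcases eq_or_ne r' [] with rfl | hne'
      · have := Path.duration_pos hne
        simp at e2
        omega
      · refine absurd ?_ (hp'.2.2.2 s.length t.length hp.1 ?_ hp.2.1 ?_)
        · dsimp only
          rw [Path.time_append_left _ _ le_rfl, Path.time_append_left _ _ le_rfl,
            Path.time_length, Path.time_length, e1]
        · simpa using List.length_pos_iff.2 hne
        · simpa using List.length_pos_iff.2 hne'
  rintro ⟨⟨p, hp⟩, u, v⟩ ⟨⟨p', hp'⟩, u', v'⟩ h
  simp only [Prod.mk.injEq] at h
  have hpp : p = p' := by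
    rcases le_total (Path.duration p.1) (Path.duration p'.1) with hd | hd
    · exact main hp hp' h.1 h.2 hd
    · exact (main hp' hp h.1.symm h.2.symm hd).symm
  subst hpp
  simpa using h

/-- Two paths that meet again are, up to their first meeting point, a closed pair. -/
theorem Path.avoid_or_exists_closedPairs (s t : Path) :
    Path.Avoid s t ∨
      ∃ p ∈ closedPairs, ∃ u v : Path, s = p.1 ++ u ∧ t = p.2 ++ v := by
  by_cases h : Path.Avoid s t
  · exact Or.inl h
  right
  have hex : ∃ i, 0 < i ∧ i ≤ s.length ∧
      ∃ k, 0 < k ∧ k ≤ t.length ∧ Path.time s i = Path.time t k := by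
    simp only [Path.Avoid] at h
    push Not at h
    obtain ⟨i, k, h1, h2, h3, h4, h5⟩ := h
    exact ⟨i, h1, h2, k, h3, h4, h5⟩
  classical
  obtain ⟨hi0, hi, k, hk0, hk, hik⟩ := Nat.find_spec hex
  have hmin := fun m => Nat.find_min hex (m := m)
  generalize Nat.find hex = i at *
  have ts : ∀ {m}, m ≤ i → Path.time (s.take i) m = Path.time s m := by
    intro m hm
    simp [Path.time, List.take_take, min_eq_left hm]
  have tt : ∀ {m}, m ≤ k → Path.time (t.take k) m = Path.time t m := by
    intro m hm
    simp [Path.time, List.take_take, min_eq_left hm]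
  have ls : (s.take i).length = i := by simp [hi]
  have lt : (t.take k).length = k := by simp [hk]
  refine ⟨(s.take i, t.take k), ⟨?_, ?_, ?_, ?_⟩, s.drop i, t.drop k, by simp, by simp⟩
  · rw [ls]; exact hi0
  · rw [lt]; exact hk0
  · simp only [ls, lt]
    rw [ts le_rfl, tt le_rfl, hik]
  · intro m l hm0 hm hl0 hl
    simp only [ls, lt] at hm hl ⊢
    rw [ts hm.le, tt hl.le]
    intro heq
    exact hmin m hm ⟨hm0, by omega, l, hl0, by omega, heq⟩

/-! ### Squaring the path expansion -/

/-- The contribution to the square of the solution at time `t` of all pairs of paths that begin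
with a given closed pair. -/
def closedTerm (a : ℤ → ℕ+ → ℝ≥0) (b : ℤ → ℝ≥0) (t : ℕ) (p : Path × Path) : ℝ≥0∞ :=
  if Path.duration p.1 ≤ t then
    (Path.weightFrom a t p.1 : ℝ≥0∞) * Path.weightFrom a t p.2
      * arSol a b (t - Path.duration p.1) ^ 2 else 0

theorem tsum_mul_tsum_eq {α β : Type*} (f : α → ℝ≥0∞) (g : β → ℝ≥0∞) :
    (∑' x, f x) * ∑' y, g y = ∑' p : α × β, f p.1 * g p.2 := by
  rw [ENNReal.tsum_prod', ← ENNReal.tsum_mul_right]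
  exact tsum_congr fun x => ENNReal.tsum_mul_left.symm

theorem closedTerm_eq_tsum (a : ℤ → ℕ+ → ℝ≥0) (b : ℤ → ℝ≥0) (t : ℕ) {p : Path × Path}
    (hp : p ∈ closedPairs) :
    closedTerm a b t p = ∑' x : Path × Path,
      pathTerm a b t (p.1 ++ x.1) * pathTerm a b t (p.2 ++ x.2) := by
  have e := closedPairs.duration_eq hp
  rw [← tsum_mul_tsum_eq (fun u => pathTerm a b t (p.1 ++ u)) (fun u => pathTerm a b t (p.2 ++ u))]
  simp_rw [pathTerm_append, ← e]
  unfold closedTerm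
  split_ifs with h
  · rw [ENNReal.tsum_mul_left, ENNReal.tsum_mul_left, ← arSol_eq_tsum_pathTerm]
    ring
  · simp

theorem sq_add_tsum_closedTerm_le (a : ℤ → ℕ+ → ℝ≥0) (b : ℤ → ℝ≥0) (t : ℕ) :
    (b t : ℝ≥0∞) ^ 2 + ∑' p : closedPairs, closedTerm a b t p ≤ arSol a b t ^ 2 := by
  rw [arSol_eq_tsum_pathTerm a b t, sq (∑' s, _), tsum_mul_tsum_eq]
  let F : Unit ⊕ (closedPairs × (Path × Path)) → Path × Path := Sum.elim (fun _ => ([], []))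
    (fun x => ((x.1 : Path × Path).1 ++ x.2.1, (x.1 : Path × Path).2 ++ x.2.2))
  have hF : Function.Injective F := by
    have hne : ∀ (p : closedPairs) (y : Path × Path),
        (([], []) : Path × Path) ≠ ((p : Path × Path).1 ++ y.1, (p : Path × Path).2 ++ y.2) := by
      rintro ⟨p, hp⟩ y h
      simp only [Prod.mk.injEq] at h
      have := hp.1
      have h1 := congrArg List.length h.1
      rw [List.length_nil, List.length_append] at h1
      omega
    rintro (_ | x) (_ | y) h
    · rfl
    · exact absurd h (hne _ _)
    · exact absurd h.symm (hne _ _)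
    · exact congrArg _ (closedPairs.append_injective h)
  refine le_trans (le_of_eq ?_) (ENNReal.tsum_comp_le_tsum_of_injective hF _)
  rw [Summable.tsum_sum ENNReal.summable ENNReal.summable]
  congr 1
  · simp [F, sq]
  · rw [ENNReal.tsum_prod']
    exact tsum_congr fun p => closedTerm_eq_tsum a b t p.2

open Classical in
/-- The contribution to the square of the solution at time `t` of a pair of non-trivial paths,
each given by its first jump and the remainder, that never meet again. -/
def avoidTerm (a : ℤ → ℕ+ → ℝ≥0) (b : ℤ → ℝ≥0) (t : ℕ)
    (x : (ℕ+ × Path) × (ℕ+ × Path)) : ℝ≥0∞ :=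
  if Path.Avoid (x.1.1 :: x.1.2) (x.2.1 :: x.2.2) then
    pathTerm a b t (x.1.1 :: x.1.2) * pathTerm a b t (x.2.1 :: x.2.2) else 0

/-- The solution is the noise plus a part whose square is controlled by the closed pairs and by
the pairs that never meet again. -/
theorem exists_arSol_eq_add (a : ℤ → ℕ+ → ℝ≥0) (b : ℤ → ℝ≥0) (t : ℕ) :
    ∃ y : ℝ≥0∞, arSol a b t = y + b t ∧
      y ^ 2 ≤ ∑' p : closedPairs, closedTerm a b t p + ∑' x, avoidTerm a b t x := by
  refine ⟨∑' x : ℕ+ × Path, pathTerm a b t (x.1 :: x.2), ?_, ?_⟩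
  · rw [arSol_eq_tsum_pathTerm, tsum_list_eq, pathTerm_nil, add_comm]
  · rw [sq, tsum_mul_tsum_eq]
    let f : (ℕ+ × Path) × (ℕ+ × Path) → ℝ≥0∞ := fun x =>
      pathTerm a b t (x.1.1 :: x.1.2) * pathTerm a b t (x.2.1 :: x.2.2)
    let m : Set ((ℕ+ × Path) × (ℕ+ × Path)) :=
      {x | ¬ Path.Avoid (x.1.1 :: x.1.2) (x.2.1 :: x.2.2)}
    have hsplit : ∀ x, f x = m.indicator f x + avoidTerm a b t x := by
      intro x
      by_cases h : Path.Avoid (x.1.1 :: x.1.2) (x.2.1 :: x.2.2)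
      · simp [m, f, avoidTerm, h]
      · simp [m, f, avoidTerm, h]
    refine (tsum_congr hsplit).trans_le ?_
    rw [ENNReal.tsum_add, ← tsum_subtype]
    gcongr
    have hex : ∀ x : m, ∃ y : closedPairs × (Path × Path),
        (x : (ℕ+ × Path) × (ℕ+ × Path)).1.1 :: (x : (ℕ+ × Path) × (ℕ+ × Path)).1.2
          = (y.1 : Path × Path).1 ++ y.2.1 ∧
        (x : (ℕ+ × Path) × (ℕ+ × Path)).2.1 :: (x : (ℕ+ × Path) × (ℕ+ × Path)).2.2
          = (y.1 : Path × Path).2 ++ y.2.2 := by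
      rintro ⟨x, hx⟩
      obtain ⟨p, hp, u, v, hu, hv⟩ := (Path.avoid_or_exists_closedPairs _ _).resolve_left hx
      exact ⟨⟨⟨p, hp⟩, u, v⟩, hu, hv⟩
    choose g hg₁ hg₂ using hex
    have hg : Function.Injective g := by
      intro x y h
      have e₁ := (hg₁ x).trans ((h ▸ hg₁ y).symm)
      have e₂ := (hg₂ x).trans ((h ▸ hg₂ y).symm)
      simp only [List.cons.injEq] at e₁ e₂
      exact Subtype.ext (Prod.ext (Prod.ext e₁.1 e₁.2) (Prod.ext e₂.1 e₂.2))
    have hsum : ∑' p : closedPairs, closedTerm a b t p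
        = ∑' y : closedPairs × (Path × Path),
          pathTerm a b t ((y.1 : Path × Path).1 ++ y.2.1)
            * pathTerm a b t ((y.1 : Path × Path).2 ++ y.2.2) := by
      rw [ENNReal.tsum_prod']
      exact tsum_congr fun p => closedTerm_eq_tsum a b t p.2
    rw [hsum]
    refine le_trans (le_of_eq ?_) (ENNReal.tsum_comp_le_tsum_of_injective hg _)
    refine tsum_congr fun x => ?_
    rw [← hg₁, ← hg₂]

/-! ### Minkowski inequalities for all positive exponents -/

theorem iSup_rpow {ι : Sort*} (f : ι → ℝ≥0∞) {q : ℝ} (hq : 0 < q) :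
    (⨆ i, f i) ^ q = ⨆ i, f i ^ q :=
  (ENNReal.orderIsoRpow q hq).map_iSup f

section Minkowski

variable {α : Type*} [MeasurableSpace α] {μ : Measure α} {q : ℝ}

theorem lintegral_add_rpow_le (hq : 0 < q) {f g : α → ℝ≥0∞} (hf : Measurable f)
    (hg : Measurable g) :
    (∫⁻ x, (f x + g x) ^ q ∂μ) ^ (min 1 (1 / q))
      ≤ (∫⁻ x, f x ^ q ∂μ) ^ (min 1 (1 / q)) + (∫⁻ x, g x ^ q ∂μ) ^ (min 1 (1 / q)) := by
  rcases le_total q 1 with h | h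
  · rw [min_eq_left ((one_le_div hq).2 h)]
    simp only [ENNReal.rpow_one]
    rw [← lintegral_add_left (hf.pow_const q)]
    exact lintegral_mono fun x => ENNReal.rpow_add_le_add_rpow _ _ hq.le h
  · rw [min_eq_right ((div_le_one hq).2 h)]
    exact ENNReal.lintegral_Lp_add_le hf.aemeasurable hg.aemeasurable h

/-- Minkowski's inequality for countable sums, in a form that covers the exponents `q ≤ 1`, where
`E[Z ^ q]` itself is subadditive, as well as the exponents `q ≥ 1`, where
`E[Z ^ q] ^ (1 / q)` is. -/
theorem lintegral_tsum_rpow_le {ι : Type*} [Countable ι] (hq : 0 < q) {f : ι → α → ℝ≥0∞}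
    (hf : ∀ i, Measurable (f i)) :
    (∫⁻ x, (∑' i, f i x) ^ q ∂μ) ^ (min 1 (1 / q))
      ≤ ∑' i, (∫⁻ x, f i x ^ q ∂μ) ^ (min 1 (1 / q)) := by
  classical
  have hr : 0 < min 1 (1 / q) := by positivity
  have hfin : ∀ s : Finset ι, (∫⁻ x, (∑ i ∈ s, f i x) ^ q ∂μ) ^ (min 1 (1 / q))
      ≤ ∑ i ∈ s, (∫⁻ x, f i x ^ q ∂μ) ^ (min 1 (1 / q)) := by
    intro s
    induction s using Finset.induction_on with
    | empty => simp [ENNReal.zero_rpow_of_pos hq, hq]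
    | insert i s hi ih =>
      simp only [Finset.sum_insert hi]
      exact (lintegral_add_rpow_le hq (hf i) (Finset.measurable_fun_sum s fun i _ => hf i)).trans
        (by gcongr)
  simp_rw [ENNReal.tsum_eq_iSup_sum, iSup_rpow _ hq]
  rw [lintegral_iSup_directed, iSup_rpow _ hr]
  · exact iSup_mono hfin
  · exact fun s => ((Finset.measurable_fun_sum s fun i _ => hf i).pow_const q).aemeasurable
  · refine Monotone.directed_le fun s t hst x => ?_
    exact ENNReal.rpow_le_rpow (Finset.sum_le_sum_of_subset hst) hq.le

/-- A concave power of a sum dominates every convex combination with suitably distorted weights;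
this is Hölder's inequality for sums of two terms. -/
theorem weighted_add_le_rpow (hq : 0 < q) (hq1 : q < 1) (l m : ℝ≥0∞) (h : l + m = 1)
    (u v : ℝ≥0∞) :
    l ^ (1 - q) * u ^ q + m ^ (1 - q) * v ^ q ≤ (u + v) ^ q := by
  have hc : (1 / (1 - q)).HolderConjugate (1 / q) := by
    rw [Real.holderConjugate_iff]
    refine ⟨(one_lt_div (by linarith)).2 (by linarith), by simp⟩
  have := ENNReal.inner_le_Lp_mul_Lq Finset.univ ![l ^ (1 - q), m ^ (1 - q)] ![u ^ q, v ^ q] hc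
  have h1 : 1 - q ≠ 0 := by linarith
  simpa [Fin.sum_univ_two, ← ENNReal.rpow_mul, h1, hq.ne', h] using this

/-- The reverse Minkowski inequality for two functions and exponents `q < 1`. -/
theorem add_lintegral_rpow_le (hq : 0 < q) (hq1 : q < 1) {f g : α → ℝ≥0∞}
    (hf : Measurable f) :
    (∫⁻ x, f x ^ q ∂μ) ^ (1 / q) + (∫⁻ x, g x ^ q ∂μ) ^ (1 / q)
      ≤ (∫⁻ x, (f x + g x) ^ q ∂μ) ^ (1 / q) := by
  have hq' : 0 < 1 / q := by positivity
  have hfle : (∫⁻ x, f x ^ q ∂μ) ^ (1 / q) ≤ (∫⁻ x, (f x + g x) ^ q ∂μ) ^ (1 / q) := by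
    gcongr
    exact le_self_add
  have hgle : (∫⁻ x, g x ^ q ∂μ) ^ (1 / q) ≤ (∫⁻ x, (f x + g x) ^ q ∂μ) ^ (1 / q) := by
    gcongr
    exact le_add_self
  set F := (∫⁻ x, f x ^ q ∂μ) ^ (1 / q) with hF
  set G := (∫⁻ x, g x ^ q ∂μ) ^ (1 / q) with hG
  have eF : ∫⁻ x, f x ^ q ∂μ = F ^ q := by
    rw [hF, ← ENNReal.rpow_mul, one_div_mul_cancel hq.ne', ENNReal.rpow_one]
  have eG : ∫⁻ x, g x ^ q ∂μ = G ^ q := by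
    rw [hG, ← ENNReal.rpow_mul, one_div_mul_cancel hq.ne', ENNReal.rpow_one]
  rcases eq_or_ne F ∞ with h | hFt
  · rw [h] at hfle ⊢
    simpa using hfle
  rcases eq_or_ne G ∞ with h | hGt
  · rw [h] at hgle ⊢
    simpa using hgle
  rcases eq_or_ne (F + G) 0 with h0 | h0
  · rw [h0]
    exact zero_le
  have ht : F + G ≠ ∞ := ENNReal.add_ne_top.2 ⟨hFt, hGt⟩
  have hone : F / (F + G) + G / (F + G) = 1 := by
    rw [← ENNReal.add_div, ENNReal.div_self h0 ht]
  -- integrate the two-term Hölder inequality with the weights for which it is an equality at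
  -- the pair `(F, G)`
  have hint : (F / (F + G)) ^ (1 - q) * F ^ q + (G / (F + G)) ^ (1 - q) * G ^ q
      ≤ ∫⁻ x, (f x + g x) ^ q ∂μ := by
    have hl : (F / (F + G)) ^ (1 - q) ≠ ∞ :=
      ENNReal.rpow_ne_top_of_nonneg (by linarith) (ENNReal.div_ne_top hFt h0)
    have hm : (G / (F + G)) ^ (1 - q) ≠ ∞ :=
      ENNReal.rpow_ne_top_of_nonneg (by linarith) (ENNReal.div_ne_top hGt h0)
    rw [← eF, ← eG, ← lintegral_const_mul' _ _ hl, ← lintegral_const_mul' _ _ hm,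
      ← lintegral_add_left ((hf.pow_const q).const_mul _)]
    exact lintegral_mono fun x => weighted_add_le_rpow hq hq1 _ _ hone _ _
  have hterm : ∀ H : ℝ≥0∞, H ≠ ∞ →
      (H / (F + G)) ^ (1 - q) * H ^ q = H * ((F + G)⁻¹) ^ (1 - q) := by
    intro H hH
    rw [div_eq_mul_inv, ENNReal.mul_rpow_of_nonneg _ _ (by linarith), mul_right_comm,
      ← ENNReal.rpow_add_of_nonneg _ _ (by linarith) hq.le, sub_add_cancel, ENNReal.rpow_one]
  rw [hterm F hFt, hterm G hGt, ← add_mul, ENNReal.inv_rpow, ← ENNReal.rpow_neg] at hint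
  have : (F + G) * (F + G) ^ (-(1 - q)) = (F + G) ^ q := by
    nth_rewrite 1 [← ENNReal.rpow_one (F + G)]
    rw [← ENNReal.rpow_add _ _ h0 ht]
    congr 1
    ring
  rw [this] at hint
  calc F + G = ((F + G) ^ q) ^ (1 / q) := by
        rw [← ENNReal.rpow_mul, mul_one_div_cancel hq.ne', ENNReal.rpow_one]
    _ ≤ _ := by gcongr

theorem add_lintegral_rpow_max_le (hq : 0 < q) {f g : α → ℝ≥0∞} (hf : Measurable f) :
    (∫⁻ x, f x ^ q ∂μ) ^ (max 1 (1 / q)) + (∫⁻ x, g x ^ q ∂μ) ^ (max 1 (1 / q))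
      ≤ (∫⁻ x, (f x + g x) ^ q ∂μ) ^ (max 1 (1 / q)) := by
  rcases lt_or_ge q 1 with h | h
  · rw [max_eq_right ((one_le_div hq).2 h.le)]
    exact add_lintegral_rpow_le hq h hf
  · rw [max_eq_left ((div_le_one hq).2 h)]
    simp only [ENNReal.rpow_one]
    rw [← lintegral_add_left (hf.pow_const q)]
    exact lintegral_mono fun x => ENNReal.add_rpow_le_rpow_add _ _ h

/-- The reverse Minkowski inequality for sums: `E[Z ^ q]` is superadditive for `q ≥ 1`, and
`E[Z ^ q] ^ (1 / q)` is for `q ≤ 1`. -/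
theorem tsum_lintegral_rpow_le {ι : Type*} (hq : 0 < q) {f : ι → α → ℝ≥0∞}
    (hf : ∀ i, Measurable (f i)) :
    ∑' i, (∫⁻ x, f i x ^ q ∂μ) ^ (max 1 (1 / q))
      ≤ (∫⁻ x, (∑' i, f i x) ^ q ∂μ) ^ (max 1 (1 / q)) := by
  classical
  have hr : 0 < max 1 (1 / q) := by positivity
  have hfin : ∀ s : Finset ι, ∑ i ∈ s, (∫⁻ x, f i x ^ q ∂μ) ^ (max 1 (1 / q))
      ≤ (∫⁻ x, (∑ i ∈ s, f i x) ^ q ∂μ) ^ (max 1 (1 / q)) := by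
    intro s
    induction s using Finset.induction_on with
    | empty => simp
    | insert i s hi ih =>
      simp only [Finset.sum_insert hi]
      exact le_trans (by gcongr) (add_lintegral_rpow_max_le hq (hf i))
  rw [ENNReal.tsum_eq_iSup_sum]
  refine iSup_le fun s => (hfin s).trans ?_
  gcongr
  exact ENNReal.sum_le_tsum s

end Minkowski

/-! ### Elementary estimates -/

theorem sq_rpow_half (x : ℝ≥0∞) (θ : ℝ) : (x ^ 2) ^ (θ / 2) = x ^ θ := by
  rw [← ENNReal.rpow_natCast, ← ENNReal.rpow_mul]
  congr 1
  push_cast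
  ring

theorem lintegral_rpow_half_lt_top {Ω : Type*} [MeasurableSpace Ω] {P : Measure Ω}
    [IsProbabilityMeasure P] {Z : Ω → ℝ≥0∞} {θ : ℝ} (hθ : 0 < θ)
    (hZ : ∫⁻ ω, Z ω ^ θ ∂P < ∞) : ∫⁻ ω, Z ω ^ (θ / 2) ∂P < ∞ := by
  refine lt_of_le_of_lt (lintegral_mono fun ω => (?_ : Z ω ^ (θ / 2) ≤ 1 + Z ω ^ θ)) ?_
  · rcases le_total (Z ω) 1 with h1 | h1
    · exact (ENNReal.rpow_le_one h1 (by positivity)).trans le_self_add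
    · exact (ENNReal.rpow_le_rpow_of_exponent_le h1 (by linarith)).trans le_add_self
  · rw [lintegral_add_left measurable_const]
    simpa using hZ

theorem exists_scale {S : ℝ≥0∞} (hS : S < 1) {p : ℝ} (hp : 0 < p) :
    ∃ c : ℝ≥0, 1 < c ∧ (c : ℝ≥0∞) ^ p * S < 1 := by
  lift S to ℝ≥0 using (hS.trans ENNReal.one_lt_top).ne
  have hS' : S < 1 := by exact_mod_cast hS
  have hd : 1 < 2 / (1 + S) := by
    rw [one_lt_div (by positivity), ← one_add_one_eq_two]
    gcongr
  refine ⟨(2 / (1 + S)) ^ (1 / p), NNReal.one_lt_rpow hd (by positivity), ?_⟩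
  rw [← ENNReal.coe_rpow_of_nonneg _ hp.le, ← NNReal.rpow_mul, one_div_mul_cancel hp.ne',
    NNReal.rpow_one]
  norm_cast
  rw [div_mul_eq_mul_div, div_lt_one (by positivity), two_mul]
  gcongr

/-- The square of a sum, with a constant in front of the first square that is as close to one as
desired. -/
theorem exists_add_sq_le {c : ℝ≥0} (hc : 1 < c) :
    ∃ C : ℝ≥0, ∀ u v : ℝ≥0∞, (u + v) ^ 2 ≤ c * u ^ 2 + C * v ^ 2 := by
  have hc' : (1 : ℝ) < c := by exact_mod_cast hc
  have hC : 0 < c / (c - 1) := div_pos (zero_lt_one.trans hc) (tsub_pos_of_lt hc)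
  refine ⟨c / (c - 1), fun u v => ?_⟩
  rcases eq_or_ne u ∞ with rfl | hu
  · simp [(zero_lt_one.trans hc).ne']
  rcases eq_or_ne v ∞ with rfl | hv
  · rw [ENNReal.top_pow two_ne_zero, ENNReal.mul_top (by exact_mod_cast hC.ne')]
    simp
  lift u to ℝ≥0 using hu
  lift v to ℝ≥0 using hv
  norm_cast
  rw [← NNReal.coe_le_coe]
  push_cast [NNReal.coe_sub hc.le]
  have h1 : (0 : ℝ) < c - 1 := by linarith
  rw [← sub_nonneg]
  have : (c : ℝ) * u ^ 2 + c / (c - 1) * v ^ 2 - (u + v) ^ 2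
      = ((c - 1) * u - v) ^ 2 / (c - 1) := by
    field_simp
    ring
  rw [this]
  positivity

/-! ### Renewal inequalities -/

section Renewal

variable {ι : Type*} {M : ℕ → ℝ≥0∞} {β : ℝ≥0∞} {c : ι → ℝ≥0∞} {e : ι → ℕ}

/-- A subsolution of a renewal equation with defective weights is bounded. -/
theorem iSup_lt_top_of_le_renewal (he : ∀ i, 0 < e i) (hβ : β ≠ ∞) (hc : ∑' i, c i < 1)
    (hM : ∀ t, M t ≤ β + ∑' i, if e i ≤ t then c i * M (t - e i) else 0) :
    ⨆ t, M t < ∞ := by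
  set S := ∑' i, c i
  have hS : 1 - S ≠ 0 := (tsub_pos_of_lt hc).ne'
  have hR : β / (1 - S) < ∞ := ENNReal.div_lt_top hβ hS
  refine lt_of_le_of_lt (iSup_le fun t => ?_) hR
  induction t using Nat.strong_induction_on with
  | _ t ih =>
    calc M t ≤ β + ∑' i, if e i ≤ t then c i * M (t - e i) else 0 := hM t
      _ ≤ β + ∑' i, c i * (β / (1 - S)) := by
        gcongr with i
        split_ifs with h
        · have := he i
          gcongr
          exact ih _ (by omega)
        · exact zero_le
      _ = (1 - S) * (β / (1 - S)) + S * (β / (1 - S)) := by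
        rw [ENNReal.tsum_mul_right, ENNReal.mul_div_cancel hS (by finiteness)]
      _ = β / (1 - S) := by
        rw [← add_mul, tsub_add_cancel_of_le hc.le, one_mul]

/-- A monotone supersolution of a renewal equation with non-zero source and weights of total mass
at least one is unbounded. -/
theorem iSup_eq_top_of_renewal_le (hβ : β ≠ 0) (hc : 1 ≤ ∑' i, c i) (hmono : Monotone M)
    (hM : ∀ t, β + ∑' i, (if e i ≤ t then c i * M (t - e i) else 0) ≤ M t) :
    ⨆ t, M t = ∞ := by
  by_contra htop
  have key : β + (∑' i, c i) * ⨆ t, M t ≤ ⨆ t, M t := by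
    rw [ENNReal.tsum_eq_iSup_sum, ENNReal.iSup_mul, ENNReal.add_iSup]
    refine iSup_le fun s => ?_
    rw [ENNReal.mul_iSup, ENNReal.add_iSup]
    refine iSup_le fun t => ?_
    refine le_trans ?_ (le_iSup M (t + ∑ i ∈ s, e i))
    refine le_trans ?_ (hM _)
    gcongr
    rw [Finset.sum_mul]
    refine le_trans (Finset.sum_le_sum fun i hi => ?_) (ENNReal.sum_le_tsum s)
    have hle : e i ≤ ∑ i ∈ s, e i := Finset.single_le_sum (fun _ _ => Nat.zero_le _) hi
    rw [if_pos (by omega)]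
    gcongr
    exact hmono (by omega)
  have h2 : β + ⨆ t, M t ≤ ⨆ t, M t := by
    refine le_trans ?_ key
    gcongr
    exact le_mul_of_one_le_left' hc
  exact absurd h2 (not_le.2 (by rw [add_comm]; exact ENNReal.lt_add_right htop hβ))

end Renewal

/-! ### Measurability of path functionals -/

section Measurability

variable {Ω : Type*} [MeasurableSpace Ω] {A : ℤ → ℕ+ → Ω → ℝ≥0} {B : ℤ → Ω → ℝ≥0}

theorem measurable_weight (s : Path) :
    Measurable fun a : ℤ → ℕ+ → ℝ≥0 => Path.weight a s := by
  unfold Path.weight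
  fun_prop

theorem measurable_weightFrom (t : ℤ) (s : Path)
    (hA : ∀ (v : ℤ) (j : ℕ+), t - Path.duration s ≤ v - (j : ℕ) → Measurable (A v j)) :
    Measurable fun ω => Path.weightFrom (fun v j => A v j ω) t s := by
  induction s generalizing t with
  | nil => simp [Path.weightFrom]
  | cons j s ih =>
    simp only [Path.weightFrom]
    rw [Path.duration_cons] at hA
    refine (hA t j (by push_cast; omega)).mul (ih _ fun v k hv => hA v k ?_)
    push_cast
    omega

theorem measurable_arSol (t : ℕ) (hA : ∀ v ≤ (t : ℤ), ∀ j, Measurable (A v j))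
    (hB : ∀ v ≤ (t : ℤ), Measurable (B v)) :
    Measurable fun ω => arSol (fun v j => A v j ω) (fun v => B v ω) t := by
  induction t using Nat.strong_induction_on with
  | _ t ih =>
    have : ∀ j : ℕ+, Measurable fun ω => if (j : ℕ) ≤ t then
        (A t j ω : ℝ≥0∞) * arSol (fun v j => A v j ω) (fun v => B v ω) (t - (j : ℕ)) else 0 := by
      intro j
      by_cases h : (j : ℕ) ≤ t
      · have := j.pos
        simp only [if_pos h]
        exact (hA _ le_rfl j).coe_nnreal_ennreal.mul
          (ih _ (by omega) (fun v hv => hA v (by omega)) fun v hv => hB v (by omega))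
      · simp [if_neg h]
    have heq : (fun ω => arSol (fun v j => A v j ω) (fun v => B v ω) t) = fun ω =>
        (∑' j : ℕ+, if (j : ℕ) ≤ t then (A t j ω : ℝ≥0∞)
          * arSol (fun v j => A v j ω) (fun v => B v ω) (t - (j : ℕ)) else 0) + B t ω :=
      funext fun ω => by rw [arSol]
    rw [heq]
    exact (Measurable.tsum this).add (hB _ le_rfl).coe_nnreal_ennreal

end Measurability

/-! ### The common structure of the two models -/

/-- The features shared by the two models. There are independent σ-algebras `m i`; the coefficient
`A_{t,j}` is measurable with respect to `m (ρ t j)`, the noise `B_t` with respect to `m (σ t)`.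
Coefficients sharing an index belong to jumps that start at the same time or that end at the same
time, and a noise variable can share its index only with the coefficients of the same time.
Moreover the joint law of coefficients and noise is invariant under time shifts. -/
structure IsIndexed {Ω ι : Type*} [mΩ : MeasurableSpace Ω] (P : Measure Ω)
    (A : ℤ → ℕ+ → Ω → ℝ≥0) (B : ℤ → Ω → ℝ≥0) (m : ι → MeasurableSpace Ω)
    (ρ : ℤ → ℕ+ → ι) (σ : ℤ → ι) : Prop where
  le : ∀ i, m i ≤ mΩ
  indep : iIndep m P
  measurable_coeff : ∀ t j, Measurable[m (ρ t j)] (A t j)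
  measurable_noise : ∀ t, Measurable[m (σ t)] (B t)
  noise_index_inj : ∀ s t, σ s = σ t → s = t
  noise_index_eq : ∀ s t j, σ s = ρ t j → s = t
  coeff_index_eq : ∀ s i t j, ρ s i = ρ t j →
    s = t ∨ s - ((i : ℕ) : ℤ) = t - ((j : ℕ) : ℤ)
  stationary : ∀ k : ℤ, IdentDistrib
    (fun ω => ((fun (t : ℤ) (j : ℕ+) => A (t + k) j ω), fun t : ℤ => B (t + k) ω))
    (fun ω => ((fun (t : ℤ) (j : ℕ+) => A t j ω), fun t : ℤ => B t ω)) P P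

/-- Shifting the index of an iid family does not change its law. -/
theorem identDistrib_shift {Ω Ω₀ E : Type*} [MeasurableSpace Ω] [MeasurableSpace Ω₀]
    [MeasurableSpace E] {P : Measure Ω} {P₀ : Measure Ω₀} [IsProbabilityMeasure P]
    {X : ℤ → Ω → E} {X₀ : Ω₀ → E} (hX : iIndepFun X P)
    (hc : ∀ t, IdentDistrib (X t) X₀ P P₀) (k : ℤ) :
    IdentDistrib (fun ω t => X (t + k) ω) (fun ω t => X t ω) P P :=
  IdentDistrib.pi (fun t => (hc (t + k)).trans (hc t).symm)
    (hX.precomp (add_left_injective k)) hX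

theorem isIndexed_of_assumptionA1 {Ω₀ Ω : Type*} [MeasurableSpace Ω₀] [MeasurableSpace Ω]
    {P₀ : Measure Ω₀} {P : Measure Ω} [IsProbabilityMeasure P]
    {A₀ : ℕ+ → Ω₀ → ℝ≥0} {B₀ : Ω₀ → ℝ≥0}
    {A : ℤ → ℕ+ → Ω → ℝ≥0} {B : ℤ → Ω → ℝ≥0}
    (hA : ∀ t j, Measurable (A t j)) (hB : ∀ t, Measurable (B t))
    (h : AssumptionA1 P₀ A₀ B₀ P A B) :
    IsIndexed P A B
      (fun t : ℤ => MeasurableSpace.comap (fun ω => ((fun j : ℕ+ => A t j ω), B t ω)) inferInstance)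
      (fun t _ => t) (fun t => t) where
  le t := Measurable.comap_le
    ((measurable_pi_lambda _ fun j => hA t j).prodMk (hB t))
  indep := (iIndepFun_iff_iIndep _ _ _).1 h.indep
  measurable_coeff t j :=
    ((measurable_pi_apply j).comp measurable_fst).comp
      (comap_measurable fun ω => ((fun j : ℕ+ => A t j ω), B t ω))
  measurable_noise t := measurable_snd.comp
    (comap_measurable fun ω => ((fun j : ℕ+ => A t j ω), B t ω))
  noise_index_inj _ _ h := h
  noise_index_eq _ _ _ h := h
  coeff_index_eq _ _ _ _ h := Or.inl h
  stationary k := by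
    have hm : Measurable fun x : ℤ → (ℕ+ → ℝ≥0) × ℝ≥0 =>
        ((fun (t : ℤ) (j : ℕ+) => (x t).1 j), fun t : ℤ => (x t).2) := by fun_prop
    exact (identDistrib_shift h.indep h.copies k).comp hm

/-- Two independent families of independent σ-algebras form one such family. -/
theorem iIndep_sumElim {Ω ι κ : Type*} [MeasurableSpace Ω] {P : Measure Ω}
    {m : ι → MeasurableSpace Ω} {n : κ → MeasurableSpace Ω} (hm : iIndep m P) (hn : iIndep n P)
    (h : Indep (⨆ i, m i) (⨆ k, n k) P) : iIndep (Sum.elim m n) P := by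
  rw [iIndep_iff]
  intro S f hf
  have hL : MeasurableSet[⨆ i, m i] (⋂ i ∈ S.toLeft, f (Sum.inl i)) :=
    MeasurableSet.biInter S.toLeft.countable_toSet fun i hi =>
      le_iSup m i _ (hf _ (Finset.mem_toLeft.1 hi))
  have hR : MeasurableSet[⨆ k, n k] (⋂ k ∈ S.toRight, f (Sum.inr k)) :=
    MeasurableSet.biInter S.toRight.countable_toSet fun k hk =>
      le_iSup n k _ (hf _ (Finset.mem_toRight.1 hk))
  have hS : ⋂ i ∈ S, f i
      = (⋂ i ∈ S.toLeft, f (Sum.inl i)) ∩ ⋂ k ∈ S.toRight, f (Sum.inr k) := by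
    ext ω
    simp only [Set.mem_iInter, Set.mem_inter_iff, Finset.mem_toLeft, Finset.mem_toRight]
    exact ⟨fun h => ⟨fun i hi => h _ hi, fun k hk => h _ hk⟩, fun h i hi => by
      rcases i with i | k
      exacts [h.1 i hi, h.2 k hi]⟩
  rw [hS, (Indep_iff _ _ _).1 h _ _ hL hR,
    hm.meas_biInter fun i hi => hf _ (Finset.mem_toLeft.1 hi),
    hn.meas_biInter fun k hk => hf _ (Finset.mem_toRight.1 hk)]
  conv_rhs => rw [← Finset.toLeft_disjSum_toRight (u := S), Finset.prod_disjSum]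

theorem exists_isIndexed_of_assumptionA2 {Ω₀ Ω : Type*} [MeasurableSpace Ω₀] [MeasurableSpace Ω]
    {P₀ : Measure Ω₀} {P : Measure Ω} [IsProbabilityMeasure P]
    {A₀ : ℕ+ → Ω₀ → ℝ≥0} {B₀ : Ω₀ → ℝ≥0}
    {A : ℤ → ℕ+ → Ω → ℝ≥0} {B : ℤ → Ω → ℝ≥0}
    (hA : ∀ t j, Measurable (A t j)) (hB : ∀ t, Measurable (B t))
    (h : AssumptionA2 P₀ A₀ B₀ P A B) :
    ∃ m : ℤ ⊕ ℤ → MeasurableSpace Ω,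
      IsIndexed P A B m (fun t j => Sum.inl (t - (j : ℕ))) Sum.inr := by
  obtain ⟨A', hAA', hind, hcop⟩ := h.coeff
  have hA' : ∀ t j, A' t j = A (t + (j : ℕ)) j := by
    intro t j
    funext ω
    rw [hAA']
    congr
    ring
  have hA'm : ∀ t j, Measurable (A' t j) := fun t j => by rw [hA']; exact hA _ _
  have hpi : ∀ t, Measurable fun (ω : Ω) (j : ℕ+) => A' t j ω :=
    fun t => measurable_pi_lambda _ fun j => hA'm t j
  have hAB : IndepFun (fun (ω : Ω) (t : ℤ) (j : ℕ+) => A' t j ω) (fun (ω : Ω) (t : ℤ) => B t ω)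
      P := by
    have hφ : Measurable fun (a : ℤ → ℕ+ → ℝ≥0) (t : ℤ) (j : ℕ+) => a (t + (j : ℕ)) j := by
      fun_prop
    have := (h.noise_coeff_indep.symm).comp hφ measurable_id
    simpa only [Function.comp_def, ← hA', id] using this
  have hmA : Measurable fun (ω : Ω) (t : ℤ) (j : ℕ+) => A' t j ω := measurable_pi_lambda _ hpi
  refine ⟨Sum.elim (fun t => MeasurableSpace.comap (fun (ω : Ω) (j : ℕ+) => A' t j ω) inferInstance)
    (fun t => MeasurableSpace.comap (B t) inferInstance), ?_, ?_, ?_, ?_, ?_, ?_, ?_, ?_⟩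
  · rintro (t | t)
    · exact (hpi t).comap_le
    · exact (hB t).comap_le
  · refine iIndep_sumElim ((iIndepFun_iff_iIndep _ _ _).1 hind)
      ((iIndepFun_iff_iIndep _ _ _).1 h.noise_indep) ?_
    refine indep_of_indep_of_le_left (indep_of_indep_of_le_right
      ((IndepFun_iff_Indep _ _ _).1 hAB) (iSup_le fun t => ?_)) (iSup_le fun t => ?_)
    · exact ((measurable_pi_apply t).comp
        (comap_measurable fun (ω : Ω) (t : ℤ) => B t ω)).comap_le
    · exact ((measurable_pi_apply t).comp
        (comap_measurable fun (ω : Ω) (t : ℤ) (j : ℕ+) => A' t j ω)).comap_le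
  · intro t j
    have : A t j = fun ω => A' (t - (j : ℕ)) j ω := funext fun ω => hAA' t j ω
    rw [this]
    exact (measurable_pi_apply j).comp
      (comap_measurable fun (ω : Ω) (i : ℕ+) => A' (t - (j : ℕ)) i ω)
  · intro t
    exact comap_measurable _
  · intro s t hst
    exact Sum.inr_injective hst
  · intro s t j hst
    exact absurd hst (by simp)
  · intro s i t j hst
    exact Or.inr (Sum.inl_injective hst)
  · intro k
    have hm : Measurable fun x : (ℤ → ℕ+ → ℝ≥0) × (ℤ → ℝ≥0) =>
        ((fun (t : ℤ) (j : ℕ+) => x.1 (t - (j : ℕ)) j), x.2) := by fun_prop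
    have hsh : IndepFun (fun (ω : Ω) (t : ℤ) (j : ℕ+) => A' (t + k) j ω)
        (fun (ω : Ω) (t : ℤ) => B (t + k) ω) P :=
      hAB.comp (φ := fun (x : ℤ → ℕ+ → ℝ≥0) (t : ℤ) => x (t + k))
        (ψ := fun (x : ℤ → ℝ≥0) (t : ℤ) => x (t + k)) (by fun_prop) (by fun_prop)
    have := ((identDistrib_shift hind hcop k).prodMk
      (identDistrib_shift h.noise_indep h.noise_copies k) hsh hAB).comp hm
    simpa only [Function.comp_def, hAA', sub_add_eq_add_sub] using this

section PathPow

variable {Ω : Type*} {A : ℤ → ℕ+ → Ω → ℝ≥0} {B : ℤ → Ω → ℝ≥0}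

/-- A power of the contribution of a path that starts at time `u`. -/
def pathPow (A : ℤ → ℕ+ → Ω → ℝ≥0) (B : ℤ → Ω → ℝ≥0) (q : ℝ) (u : ℤ) (s : Path) (ω : Ω) : ℝ≥0∞ :=
  (Path.weightFrom (fun v j => A v j ω) u s : ℝ≥0∞) ^ q * (B (u - Path.duration s) ω : ℝ≥0∞) ^ q

theorem pathPow_nil (q : ℝ) (u : ℤ) (ω : Ω) : pathPow A B q u [] ω = (B u ω : ℝ≥0∞) ^ q := by
  simp [pathPow, Path.weightFrom]

theorem pathPow_cons {q : ℝ} (hq : 0 ≤ q) (u : ℤ) (j : ℕ+) (s : Path) (ω : Ω) :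
    pathPow A B q u (j :: s) ω
      = (A u j ω : ℝ≥0∞) ^ q * pathPow A B q (u - (j : ℕ)) s ω := by
  unfold pathPow
  rw [Path.weightFrom, ENNReal.coe_mul, ENNReal.mul_rpow_of_nonneg _ _ hq, mul_assoc,
    Path.duration_cons]
  push_cast
  rw [sub_sub]

theorem pathTerm_rpow_le {q : ℝ} (hq : 0 < q) (t : ℕ) (s : Path) (ω : Ω) :
    pathTerm (fun v j => A v j ω) (fun v => B v ω) t s ^ q ≤ pathPow A B q t s ω := by
  unfold pathTerm pathPow
  split_ifs with hd
  · rw [ENNReal.mul_rpow_of_nonneg _ _ hq.le, Nat.cast_sub hd]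
  · rw [ENNReal.zero_rpow_of_pos hq]
    exact zero_le

end PathPow

namespace IsIndexed

variable {Ω ι : Type*} [mΩ : MeasurableSpace Ω] {P : Measure Ω}
  {A : ℤ → ℕ+ → Ω → ℝ≥0} {B : ℤ → Ω → ℝ≥0} {m : ι → MeasurableSpace Ω}
  {ρ : ℤ → ℕ+ → ι} {σ : ℤ → ι}

theorem measurable_coeff' (h : IsIndexed P A B m ρ σ) (t : ℤ) (j : ℕ+) : Measurable (A t j) :=
  (h.measurable_coeff t j).mono (h.le _) le_rfl

theorem measurable_noise' (h : IsIndexed P A B m ρ σ) (t : ℤ) : Measurable (B t) :=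
  (h.measurable_noise t).mono (h.le _) le_rfl

theorem measurable_solution (h : IsIndexed P A B m ρ σ) (t : ℕ) :
    Measurable fun ω => arSol (fun v j => A v j ω) (fun v => B v ω) t :=
  measurable_arSol t (fun v _ j => h.measurable_coeff' v j) fun v _ => h.measurable_noise' v

theorem measurable_pathWeight (h : IsIndexed P A B m ρ σ) (t : ℤ) (s : Path) :
    Measurable fun ω => Path.weightFrom (fun v j => A v j ω) t s :=
  measurable_weightFrom t s fun v j _ => h.measurable_coeff' v j

/-! ### Consequences of stationarity -/

theorem lintegral_shift (h : IsIndexed P A B m ρ σ) (k : ℤ)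
    {Φ : (ℤ → ℕ+ → ℝ≥0) × (ℤ → ℝ≥0) → ℝ≥0∞} (hΦ : Measurable Φ) :
    ∫⁻ ω, Φ ((fun t j => A (t + k) j ω), fun t => B (t + k) ω) ∂P
      = ∫⁻ ω, Φ ((fun t j => A t j ω), fun t => B t ω) ∂P :=
  ((h.stationary k).comp hΦ).lintegral_eq

theorem lintegral_coeff (h : IsIndexed P A B m ρ σ) (q : ℝ) (t : ℤ) (j : ℕ+) :
    ∫⁻ ω, (A t j ω : ℝ≥0∞) ^ q ∂P = ∫⁻ ω, (A 0 j ω : ℝ≥0∞) ^ q ∂P := by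
  have := h.lintegral_shift t (Φ := fun x => (x.1 0 j : ℝ≥0∞) ^ q) (by fun_prop)
  simpa using this

theorem lintegral_noise (h : IsIndexed P A B m ρ σ) (q : ℝ) (t : ℤ) :
    ∫⁻ ω, (B t ω : ℝ≥0∞) ^ q ∂P = ∫⁻ ω, (B 0 ω : ℝ≥0∞) ^ q ∂P := by
  have := h.lintegral_shift t (Φ := fun x => (x.2 0 : ℝ≥0∞) ^ q) (by fun_prop)
  simpa using this

theorem lintegral_coeff_mul_coeff (h : IsIndexed P A B m ρ σ) (q : ℝ) (t : ℤ) (i j : ℕ+) :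
    ∫⁻ ω, (A t i ω : ℝ≥0∞) ^ q * (A t j ω : ℝ≥0∞) ^ q ∂P
      = ∫⁻ ω, (A 0 i ω : ℝ≥0∞) ^ q * (A 0 j ω : ℝ≥0∞) ^ q ∂P := by
  have := h.lintegral_shift t
    (Φ := fun x => (x.1 0 i : ℝ≥0∞) ^ q * (x.1 0 j : ℝ≥0∞) ^ q) (by fun_prop)
  simpa using this

theorem lintegral_pathWeight (h : IsIndexed P A B m ρ σ) (θ : ℝ) (t : ℤ) (p : Path × Path) :
    ∫⁻ ω, (Path.weightFrom (fun v j => A v j ω) t p.1 : ℝ≥0∞) ^ (θ / 2)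
        * (Path.weightFrom (fun v j => A v j ω) t p.2 : ℝ≥0∞) ^ (θ / 2) ∂P
      = pairMoment P A θ p := by
  have hm : ∀ s : Path, Measurable fun x : (ℤ → ℕ+ → ℝ≥0) × (ℤ → ℝ≥0) =>
      (Path.weight x.1 s : ℝ≥0∞) ^ (θ / 2) := fun s =>
    ((measurable_weight s).comp measurable_fst).coe_nnreal_ennreal.pow_const _
  have := h.lintegral_shift t ((hm p.1).mul (hm p.2))
  simp only [Pi.mul_apply] at this
  unfold pairMoment
  rw [← this]
  refine lintegral_congr fun ω => ?_
  rw [← Path.weight_shift, ← Path.weight_shift]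

/-! ### Independence before and after a cutting time -/

theorem lintegral_mul_of_disjoint (h : IsIndexed P A B m ρ σ) {S T : Set ι} (hST : Disjoint S T)
    {f g : Ω → ℝ≥0∞} (hf : Measurable[⨆ i ∈ S, m i] f) (hg : Measurable[⨆ i ∈ T, m i] g) :
    ∫⁻ ω, f ω * g ω ∂P = (∫⁻ ω, f ω ∂P) * ∫⁻ ω, g ω ∂P :=
  lintegral_mul_eq_lintegral_mul_lintegral_of_independent_measurableSpace
    (iSup₂_le fun i _ => h.le i) (iSup₂_le fun i _ => h.le i)
    (indep_iSup_of_disjoint h.le h.indep hST) hf hg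

theorem coeff_measurable_iSup (h : IsIndexed P A B m ρ σ) {S : Set ι} {t : ℤ} {j : ℕ+}
    (hS : ρ t j ∈ S) : Measurable[⨆ i ∈ S, m i] (A t j) :=
  (h.measurable_coeff t j).mono (le_iSup₂ (f := fun i _ => m i) _ hS) le_rfl

theorem noise_measurable_iSup (h : IsIndexed P A B m ρ σ) {S : Set ι} {t : ℤ}
    (hS : σ t ∈ S) : Measurable[⨆ i ∈ S, m i] (B t) :=
  (h.measurable_noise t).mono (le_iSup₂ (f := fun i _ => m i) _ hS) le_rfl

/-- The indices of the jumps that end at time `v` or later. -/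
def lateIndices (ρ : ℤ → ℕ+ → ι) (v : ℤ) : Set ι :=
  {i | ∃ (u : ℤ) (j : ℕ+), v ≤ u - ((j : ℕ) : ℤ) ∧ i = ρ u j}

/-- The indices of the noise variables and of the jumps that start at time `v` or before. -/
def earlyIndices (ρ : ℤ → ℕ+ → ι) (σ : ℤ → ι) (v : ℤ) : Set ι :=
  {i | ∃ u ≤ v, i = σ u ∨ ∃ j : ℕ+, i = ρ u j}

theorem disjoint_late_early (h : IsIndexed P A B m ρ σ) (v : ℤ) :
    Disjoint (lateIndices ρ v) (earlyIndices ρ σ v) := by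
  rw [Set.disjoint_left]
  rintro i ⟨u, j, hu, rfl⟩ ⟨w, hw, hi | ⟨k, hi⟩⟩
  · have := h.noise_index_eq _ _ _ hi.symm
    have := j.pos
    omega
  · have := h.coeff_index_eq _ _ _ _ hi
    have := j.pos
    have := k.pos
    omega

theorem pathWeight_measurable_late (h : IsIndexed P A B m ρ σ) (t : ℤ) (s : Path) {v : ℤ}
    (hv : v ≤ t - Path.duration s) :
    Measurable[⨆ i ∈ lateIndices ρ v, m i]
      fun ω => Path.weightFrom (fun v j => A v j ω) t s :=
  @measurable_weightFrom _ (⨆ i ∈ lateIndices ρ v, m i) _ t s fun w j hw =>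
    h.coeff_measurable_iSup ⟨w, j, hv.trans hw, rfl⟩

theorem solution_measurable_early (h : IsIndexed P A B m ρ σ) (t : ℕ) :
    Measurable[⨆ i ∈ earlyIndices ρ σ t, m i]
      fun ω => arSol (fun v j => A v j ω) (fun v => B v ω) t :=
  @measurable_arSol _ (⨆ i ∈ earlyIndices ρ σ t, m i) _ _ t
    (fun v hv j => h.coeff_measurable_iSup ⟨v, hv, Or.inr ⟨j, rfl⟩⟩)
    fun v hv => h.noise_measurable_iSup ⟨v, hv, Or.inl rfl⟩

/-- A closed pair is independent of the solution at its end point. -/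
theorem lintegral_closedTerm_rpow (h : IsIndexed P A B m ρ σ) {θ : ℝ} (hθ : 0 < θ) (t : ℕ)
    {p : Path × Path} (hp : p ∈ closedPairs) :
    ∫⁻ ω, closedTerm (fun v j => A v j ω) (fun v => B v ω) t p ^ (θ / 2) ∂P
      = if Path.duration p.1 ≤ t then pairMoment P A θ p * ∫⁻ ω,
          (arSol (fun v j => A v j ω) (fun v => B v ω) (t - Path.duration p.1) ^ 2) ^ (θ / 2) ∂P
        else 0 := by
  have hq : 0 < θ / 2 := by positivity
  have e := closedPairs.duration_eq hp
  unfold closedTerm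
  split_ifs with hd
  · rw [← h.lintegral_pathWeight θ t p]
    simp_rw [ENNReal.mul_rpow_of_nonneg _ _ hq.le]
    have hS : ∀ s : Path, Path.duration s = Path.duration p.1 →
        Measurable[⨆ i ∈ lateIndices ρ ((t - Path.duration p.1 : ℕ) : ℤ), m i]
          fun ω => (Path.weightFrom (fun v j => A v j ω) t s : ℝ≥0∞) ^ (θ / 2) := fun s hs =>
      (h.pathWeight_measurable_late t s (by rw [hs]; omega)).coe_nnreal_ennreal.pow_const _
    exact h.lintegral_mul_of_disjoint (h.disjoint_late_early _)
      (Measurable.mul (hS p.1 rfl) (hS p.2 e.symm))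
      (((h.solution_measurable_early (t - Path.duration p.1)).pow_const 2).pow_const (θ / 2))
  · simp [ENNReal.zero_rpow_of_pos hq]

theorem lintegral_coeff_mul_solution (h : IsIndexed P A B m ρ σ) (t : ℕ) {j : ℕ+}
    (hj : (j : ℕ) ≤ t) :
    ∫⁻ ω, (A t j ω : ℝ≥0∞)
        * arSol (fun v j => A v j ω) (fun v => B v ω) (t - (j : ℕ)) ∂P
      = (∫⁻ ω, (A 0 j ω : ℝ≥0∞) ∂P)
        * ∫⁻ ω, arSol (fun v j => A v j ω) (fun v => B v ω) (t - (j : ℕ)) ∂P := by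
  have e := h.lintegral_coeff 1 t j
  simp only [ENNReal.rpow_one] at e
  rw [← e]
  exact h.lintegral_mul_of_disjoint (h.disjoint_late_early ((t - (j : ℕ) : ℕ) : ℤ))
    (h.coeff_measurable_iSup (S := lateIndices ρ ((t - (j : ℕ) : ℕ) : ℤ))
      ⟨t, j, by omega, rfl⟩).coe_nnreal_ennreal
    (h.solution_measurable_early _)

/-! ### Independence along paths that never meet again -/

/-- The indices of the random variables that enter the contribution of a path starting at `u`:
one for each jump, and one for the noise at the end. -/
def pathIndices (ρ : ℤ → ℕ+ → ι) (σ : ℤ → ι) : ℤ → Path → Set ι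
  | u, [] => {σ u}
  | u, j :: s => insert (ρ u j) (pathIndices ρ σ (u - (j : ℕ)) s)

/-- The times visited by a path that starts at `u` and runs backwards. -/
def visits (u : ℤ) (s : Path) : Set ℤ := {v | ∃ k ≤ s.length, v = u - Path.time s k}

theorem visits_cons (u : ℤ) (j : ℕ+) (s : Path) {v : ℤ} (hv : v ∈ visits (u - (j : ℕ)) s) :
    v ∈ visits u (j :: s) ∧ v ≤ u - (j : ℕ) := by
  obtain ⟨k, hk, rfl⟩ := hv
  refine ⟨⟨k + 1, by simpa using hk, ?_⟩, by omega⟩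
  rw [Path.time_cons_succ]
  push_cast
  ring

theorem start_mem_visits (u : ℤ) (s : Path) : u ∈ visits u s := ⟨0, by simp, by simp⟩

theorem mem_pathIndices {u : ℤ} {s : Path} {i : ι} (hi : i ∈ pathIndices ρ σ u s) :
    (∃ v ∈ visits u s, i = σ v) ∨ ∃ (v : ℤ) (j : ℕ+), v ∈ visits u s ∧
      v - (j : ℕ) ∈ visits u s ∧ v - (j : ℕ) < u ∧ i = ρ v j := by
  induction s generalizing u with
  | nil => exact Or.inl ⟨u, start_mem_visits u _, by simpa [pathIndices] using hi⟩
  | cons j s ih =>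
    have hj := j.pos
    rcases Set.mem_insert_iff.1 hi with rfl | hi
    · exact Or.inr ⟨u, j, start_mem_visits u _, (visits_cons u j s (start_mem_visits _ s)).1,
        by omega, rfl⟩
    · rcases ih hi with ⟨v, hv, rfl⟩ | ⟨v, k, hv, hv', hlt, rfl⟩
      · exact Or.inl ⟨v, (visits_cons u j s hv).1, rfl⟩
      · exact Or.inr ⟨v, k, (visits_cons u j s hv).1, (visits_cons u j s hv').1, by omega, rfl⟩

theorem le_of_mem_visits {u v : ℤ} {s : Path} (hv : v ∈ visits u s) : v ≤ u := by
  obtain ⟨k, -, rfl⟩ := hv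
  omega

/-- A jump that starts later than a path, and does not land on it after its starting point, uses
an index that the path does not use. -/
theorem coeff_index_notMem (h : IsIndexed P A B m ρ σ) {u t : ℤ} {j : ℕ+} {s : Path} (hu : u < t)
    (hj : t - (j : ℕ) = u ∨ t - (j : ℕ) ∉ visits u s) : ρ t j ∉ pathIndices ρ σ u s := by
  intro hi
  rcases mem_pathIndices hi with ⟨v, hv, he⟩ | ⟨v, k, hv, hv', hlt, he⟩
  · have := h.noise_index_eq _ _ _ he.symm
    have := le_of_mem_visits hv
    omega
  · have := le_of_mem_visits hv
    rcases h.coeff_index_eq _ _ _ _ he with hh | hh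
    · omega
    · rcases hj with hj | hj
      · omega
      · exact hj (hh ▸ hv')

theorem disjoint_pathIndices (h : IsIndexed P A B m ρ σ) {u u' : ℤ} {s s' : Path}
    (hd : Disjoint (visits u s) (visits u' s')) :
    Disjoint (pathIndices ρ σ u s) (pathIndices ρ σ u' s') := by
  rw [Set.disjoint_left] at hd ⊢
  intro i hi hi'
  rcases mem_pathIndices hi with ⟨v, hv, rfl⟩ | ⟨v, k, hv, hk, -, rfl⟩ <;>
    rcases mem_pathIndices hi' with ⟨w, hw, e⟩ | ⟨w, l, hw, hl, -, e⟩
  · exact hd hv (h.noise_index_inj _ _ e ▸ hw)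
  · exact hd hv (h.noise_index_eq _ _ _ e ▸ hw)
  · exact hd hv (h.noise_index_eq _ _ _ e.symm ▸ hw)
  · rcases h.coeff_index_eq _ _ _ _ e with e | e
    · exact hd hv (e ▸ hw)
    · exact hd hk (e ▸ hl)

theorem measurable_pathPow (h : IsIndexed P A B m ρ σ) {q : ℝ} (hq : 0 ≤ q) {u : ℤ} {s : Path}
    {S : Set ι} (hS : pathIndices ρ σ u s ⊆ S) :
    Measurable[⨆ i ∈ S, m i] (pathPow A B q u s) := by
  induction s generalizing u with
  | nil =>
    rw [show pathPow A B q u [] = fun ω => (B u ω : ℝ≥0∞) ^ q from funext (pathPow_nil q u)]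
    exact (h.noise_measurable_iSup (hS rfl)).coe_nnreal_ennreal.pow_const q
  | cons j s ih =>
    rw [show pathPow A B q u (j :: s) = fun ω =>
      (A u j ω : ℝ≥0∞) ^ q * pathPow A B q (u - (j : ℕ)) s ω from funext (pathPow_cons hq u j s)]
    exact Measurable.mul
      ((h.coeff_measurable_iSup (hS (Set.mem_insert _ _))).coe_nnreal_ennreal.pow_const q)
      (ih ((Set.subset_insert _ _).trans hS))

/-- The contribution of a path factorises completely, and is independent of everything that does
not use the indices of the path. -/
theorem lintegral_mul_pathPow (h : IsIndexed P A B m ρ σ) {q : ℝ} (hq : 0 ≤ q) {u : ℤ} {s : Path}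
    {F : Ω → ℝ≥0∞} (hF : Measurable[⨆ i ∈ (pathIndices ρ σ u s)ᶜ, m i] F) :
    ∫⁻ ω, F ω * pathPow A B q u s ω ∂P = (∫⁻ ω, F ω ∂P) *
      ((s.map fun j => ∫⁻ ω, (A 0 j ω : ℝ≥0∞) ^ q ∂P).prod * ∫⁻ ω, (B 0 ω : ℝ≥0∞) ^ q ∂P) := by
  induction s generalizing u F with
  | nil =>
    simp only [pathPow_nil, List.map_nil, List.prod_nil, one_mul]
    rw [← h.lintegral_noise q u]
    exact h.lintegral_mul_of_disjoint (T := {σ u}) disjoint_compl_left hF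
      ((h.noise_measurable_iSup (Set.mem_singleton _)).coe_nnreal_ennreal.pow_const q)
  | cons j s ih =>
    have hj := j.pos
    have hn : ρ u j ∉ pathIndices ρ σ (u - (j : ℕ)) s :=
      h.coeff_index_notMem (by omega) (Or.inl rfl)
    have hsub : (pathIndices ρ σ u (j :: s))ᶜ ⊆ (pathIndices ρ σ (u - (j : ℕ)) s)ᶜ :=
      Set.compl_subset_compl.2 (Set.subset_insert _ _)
    have hFA : Measurable[⨆ i ∈ (pathIndices ρ σ (u - (j : ℕ)) s)ᶜ, m i]
        fun ω => F ω * (A u j ω : ℝ≥0∞) ^ q :=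
      Measurable.mul (hF.mono (biSup_mono hsub) le_rfl)
        ((h.coeff_measurable_iSup hn).coe_nnreal_ennreal.pow_const q)
    have hsplit : ∫⁻ ω, F ω * (A u j ω : ℝ≥0∞) ^ q ∂P
        = (∫⁻ ω, F ω ∂P) * ∫⁻ ω, (A u j ω : ℝ≥0∞) ^ q ∂P :=
      h.lintegral_mul_of_disjoint (S := (pathIndices ρ σ u (j :: s))ᶜ) (T := {ρ u j})
        (Set.disjoint_singleton_right.2 fun hc => hc (Set.mem_insert _ _)) hF
        ((h.coeff_measurable_iSup (Set.mem_singleton _)).coe_nnreal_ennreal.pow_const q)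
    simp only [pathPow_cons hq, ← mul_assoc]
    rw [ih hFA, hsplit, h.lintegral_coeff, List.map_cons, List.prod_cons]
    ring

/-- The moment of the contribution of a pair of paths that never meet again factorises, except that
the two coefficients of the first jumps may be dependent. -/
theorem lintegral_avoidTerm_le (h : IsIndexed P A B m ρ σ) {q : ℝ} (hq : 0 < q) (t : ℕ)
    (x : (ℕ+ × Path) × (ℕ+ × Path)) :
    ∫⁻ ω, avoidTerm (fun v j => A v j ω) (fun v => B v ω) t x ^ q ∂P
      ≤ (if x.1.1 = x.2.1 then 0 else
          ∫⁻ ω, (A 0 x.1.1 ω : ℝ≥0∞) ^ q * (A 0 x.2.1 ω : ℝ≥0∞) ^ q ∂P) *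
        ((x.1.2.map fun j => ∫⁻ ω, (A 0 j ω : ℝ≥0∞) ^ q ∂P).prod
          * ∫⁻ ω, (B 0 ω : ℝ≥0∞) ^ q ∂P) *
        ((x.2.2.map fun j => ∫⁻ ω, (A 0 j ω : ℝ≥0∞) ^ q ∂P).prod
          * ∫⁻ ω, (B 0 ω : ℝ≥0∞) ^ q ∂P) := by
  obtain ⟨⟨i, s⟩, ⟨j, u⟩⟩ := x
  have hi := i.pos
  have hj := j.pos
  by_cases hav : Path.Avoid (i :: s) (j :: u)
  · have hij : i ≠ j := by
      rintro rfl
      exact hav 1 1 one_pos (by simp) one_pos (by simp) (by simp [Path.time])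
    have hdis : Disjoint (visits ((t : ℤ) - (i : ℕ)) s) (visits ((t : ℤ) - (j : ℕ)) u) := by
      rw [Set.disjoint_left]
      rintro v ⟨k, hk, rfl⟩ ⟨l, hl, e⟩
      refine hav (k + 1) (l + 1) (by omega) (by simpa using hk) (by omega) (by simpa using hl) ?_
      rw [Path.time_cons_succ, Path.time_cons_succ]
      omega
    have hdis' := h.disjoint_pathIndices hdis
    rw [Set.disjoint_left] at hdis
    have n1 : ρ t i ∉ pathIndices ρ σ ((t : ℤ) - (i : ℕ)) s :=
      h.coeff_index_notMem (by omega) (Or.inl rfl)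
    have n2 : ρ t j ∉ pathIndices ρ σ ((t : ℤ) - (i : ℕ)) s :=
      h.coeff_index_notMem (by omega) (Or.inr fun hc => hdis hc (start_mem_visits _ _))
    have n3 : ρ t i ∉ pathIndices ρ σ ((t : ℤ) - (j : ℕ)) u :=
      h.coeff_index_notMem (by omega) (Or.inr fun hc => hdis (start_mem_visits _ _) hc)
    have n4 : ρ t j ∉ pathIndices ρ σ ((t : ℤ) - (j : ℕ)) u :=
      h.coeff_index_notMem (by omega) (Or.inl rfl)
    have hA : ∀ {S : Set ι}, ρ t i ∈ S → ρ t j ∈ S → Measurable[⨆ i ∈ S, m i]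
        fun ω => (A t i ω : ℝ≥0∞) ^ q * (A t j ω : ℝ≥0∞) ^ q := fun h1 h2 =>
      Measurable.mul ((h.coeff_measurable_iSup h1).coe_nnreal_ennreal.pow_const q)
        ((h.coeff_measurable_iSup h2).coe_nnreal_ennreal.pow_const q)
    calc ∫⁻ ω, avoidTerm (fun v j => A v j ω) (fun v => B v ω) t ((i, s), (j, u)) ^ q ∂P
        ≤ ∫⁻ ω, ((A t i ω : ℝ≥0∞) ^ q * (A t j ω : ℝ≥0∞) ^ q
            * pathPow A B q ((t : ℤ) - (i : ℕ)) s ω)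
            * pathPow A B q ((t : ℤ) - (j : ℕ)) u ω ∂P := by
          refine lintegral_mono fun ω => ?_
          dsimp only
          rw [avoidTerm, if_pos hav, ENNReal.mul_rpow_of_nonneg _ _ hq.le]
          refine (mul_le_mul' (pathTerm_rpow_le hq t _ ω) (pathTerm_rpow_le hq t _ ω)).trans_eq ?_
          rw [pathPow_cons hq.le, pathPow_cons hq.le]
          ring
      _ = _ := by
          rw [h.lintegral_mul_pathPow hq.le, h.lintegral_mul_pathPow hq.le (hA n1 n2),
            h.lintegral_coeff_mul_coeff, if_neg hij]
          exact Measurable.mul (hA n3 n4)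
            (h.measurable_pathPow hq.le (Set.subset_compl_iff_disjoint_right.2 hdis'))
  · simp [avoidTerm, hav, ENNReal.zero_rpow_of_pos hq]

end IsIndexed

/-! ### Sums over all paths -/

theorem tsum_list_prod_le {α : Type*} (f : α → ℝ≥0∞) (hf : ∑' j, f j < 1) :
    ∑' s : List α, (s.map f).prod ≤ (1 - ∑' j, f j)⁻¹ := by
  classical
  set S := ∑' j, f j with hS
  have hne : 1 - S ≠ 0 := (tsub_pos_of_lt hf).ne'
  have hbound : ∀ n : ℕ, ∑' s : List α, (if s.length ≤ n then (s.map f).prod else 0)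
      ≤ (1 - S)⁻¹ := by
    have hrec : 1 + S * (1 - S)⁻¹ = (1 - S)⁻¹ := by
      nth_rewrite 1 [← ENNReal.mul_inv_cancel hne (by finiteness)]
      rw [← add_mul, tsub_add_cancel_of_le hf.le, one_mul]
    intro n
    induction n with
    | zero =>
      rw [tsum_list_eq]
      simp
    | succ n ih =>
      rw [tsum_list_eq, ENNReal.tsum_prod']
      calc _ = 1 + ∑' j, ∑' s : List α, f j * (if s.length ≤ n then (s.map f).prod else 0) := by
            congr 1
            simp
        _ = 1 + S * ∑' s : List α, (if s.length ≤ n then (s.map f).prod else 0) := by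
            simp_rw [ENNReal.tsum_mul_left, ENNReal.tsum_mul_right]
            rw [hS]
        _ ≤ 1 + S * (1 - S)⁻¹ := by gcongr
        _ = _ := hrec
  rw [ENNReal.tsum_eq_iSup_sum]
  refine iSup_le fun F => ?_
  refine le_trans ?_ (hbound (F.sup List.length))
  refine le_trans (Finset.sum_le_sum fun s hs => ?_) (ENNReal.sum_le_tsum F)
  rw [if_pos (Finset.le_sup (f := List.length) hs)]

theorem list_prod_map_rpow {α : Type*} (f : α → ℝ≥0∞) {r : ℝ} (hr : 0 ≤ r) (s : List α) :
    (s.map f).prod ^ r = (s.map fun j => f j ^ r).prod := by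
  induction s with
  | nil => simp
  | cons j s ih => simp [ENNReal.mul_rpow_of_nonneg _ _ hr, ih]

/-- Total size of the pairs of paths that never meet again, in terms of the mixed moments of the
first jumps and of the moments of all later jumps. -/
theorem tsum_pair_prod_lt_top (κ : ℕ+ → ℕ+ → ℝ≥0∞) (α : ℕ+ → ℝ≥0∞) (β : ℝ≥0∞) {r : ℝ} (hr : 0 ≤ r)
    (hκ : ∑' (i : ℕ+) (j : ℕ+), κ i j ^ r < ∞) (hα : ∑' j, α j ^ r < 1) (hβ : β ≠ ∞) :
    ∑' x : (ℕ+ × Path) × (ℕ+ × Path), (κ x.1.1 x.2.1 * ((x.1.2.map α).prod * β)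
      * ((x.2.2.map α).prod * β)) ^ r < ∞ := by
  set G : Path → ℝ≥0∞ := fun s => ((s.map α).prod * β) ^ r with hG
  have hW : ∑' s, G s < ∞ := by
    simp_rw [hG, ENNReal.mul_rpow_of_nonneg _ _ hr, list_prod_map_rpow α hr,
      ENNReal.tsum_mul_right]
    refine ENNReal.mul_lt_top (lt_of_le_of_lt (tsum_list_prod_le _ hα) ?_)
      (ENNReal.rpow_lt_top_of_nonneg hr hβ)
    exact ENNReal.inv_lt_top.2 (tsub_pos_of_lt hα)
  have hterm : ∀ x : (ℕ+ × Path) × (ℕ+ × Path), (κ x.1.1 x.2.1 * ((x.1.2.map α).prod * β)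
      * ((x.2.2.map α).prod * β)) ^ r = κ x.1.1 x.2.1 ^ r * G x.1.2 * G x.2.2 := fun x => by
    rw [ENNReal.mul_rpow_of_nonneg _ _ hr, ENNReal.mul_rpow_of_nonneg _ _ hr]
  simp_rw [hterm, ENNReal.tsum_prod', ENNReal.tsum_mul_left, ENNReal.tsum_mul_right,
    ENNReal.tsum_mul_left, ENNReal.tsum_mul_right]
  exact ENNReal.mul_lt_top (ENNReal.mul_lt_top hκ hW) hW

/-! ### Convergence in law -/

theorem measurable_arSol_env (t : ℕ) :
    Measurable fun x : (ℤ → ℕ+ → ℝ≥0) × (ℤ → ℝ≥0) => arSol x.1 x.2 t :=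
  measurable_arSol (A := fun v j (x : (ℤ → ℕ+ → ℝ≥0) × (ℤ → ℝ≥0)) => x.1 v j)
    (B := fun v x => x.2 v) t (fun v _ j => by fun_prop) fun v _ => by fun_prop

section PastSol

variable {Ω : Type*} {A : ℤ → ℕ+ → Ω → ℝ≥0} {B : ℤ → Ω → ℝ≥0}

/-- The solution at time zero that was started at time `-t`. -/
def pastSol (A : ℤ → ℕ+ → Ω → ℝ≥0) (B : ℤ → Ω → ℝ≥0) (t : ℕ) (ω : Ω) : ℝ≥0∞ :=
  arSol (fun v j => A (v + -(t : ℤ)) j ω) (fun v => B (v + -(t : ℤ)) ω) t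

theorem monotone_pastSol (ω : Ω) : Monotone fun t : ℕ => pastSol A B t ω := by
  refine monotone_nat_of_le_succ fun t => ?_
  refine (arSol_le_arSol_shift _ _ t).trans_eq ?_
  unfold pastSol
  congr 1
  · funext v j
    congr 1
    push_cast
    ring
  · funext v
    congr 1
    push_cast
    ring

end PastSol

namespace IsIndexed

variable {Ω ι : Type*} [mΩ : MeasurableSpace Ω] {P : Measure Ω}
  {A : ℤ → ℕ+ → Ω → ℝ≥0} {B : ℤ → Ω → ℝ≥0} {m : ι → MeasurableSpace Ω}
  {ρ : ℤ → ℕ+ → ι} {σ : ℤ → ι}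

theorem monotone_lintegral_arSol (h : IsIndexed P A B m ρ σ) {p : ℝ} (hp : 0 ≤ p) :
    Monotone fun t : ℕ => ∫⁻ ω, arSol (fun v j => A v j ω) (fun v => B v ω) t ^ p ∂P := by
  refine monotone_nat_of_le_succ fun t => ?_
  have := h.lintegral_shift (-1) ((measurable_arSol_env (t + 1)).pow_const p)
  rw [← this]
  refine lintegral_mono fun ω => ?_
  exact ENNReal.rpow_le_rpow (arSol_le_arSol_shift _ _ t) hp

theorem identDistrib_pastSol (h : IsIndexed P A B m ρ σ) (t : ℕ) :
    IdentDistrib (pastSol A B t) (fun ω => arSol (fun v j => A v j ω) (fun v => B v ω) t) P P :=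
  (h.stationary (-(t : ℤ))).comp (measurable_arSol_env t)

theorem measurable_pastSol (h : IsIndexed P A B m ρ σ) (t : ℕ) : Measurable (pastSol A B t) :=
  (measurable_arSol_env t).comp
    ((measurable_pi_lambda _ fun _ => measurable_pi_lambda _ fun j =>
      h.measurable_coeff' _ j).prodMk (measurable_pi_lambda _ fun _ => h.measurable_noise' _))

theorem tendstoInDistribution_iSup_pastSol [IsProbabilityMeasure P] (h : IsIndexed P A B m ρ σ) :
    TendstoInDistribution
      (fun (t : ℕ) (ω : Ω) => arSol (fun r j => A r j ω) (fun r => B r ω) t)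
      atTop (fun ω => ⨆ t, pastSol A B t ω) (fun _ => P) P := by
  have hpast : TendstoInDistribution (fun (t : ℕ) (ω : Ω) => pastSol A B t ω)
      atTop (fun ω => ⨆ t, pastSol A B t ω) (fun _ => P) P :=
    tendstoInDistribution_of_ae_tendsto (fun t => (h.measurable_pastSol t).aemeasurable)
      (Measurable.iSup h.measurable_pastSol).aemeasurable
      (ae_of_all _ fun ω => tendsto_atTop_iSup (monotone_pastSol ω))
  refine ⟨fun t => (h.measurable_solution t).aemeasurable, hpast.aemeasurable_limit, ?_⟩
  refine Tendsto.congr (fun t => ?_) hpast.tendsto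
  exact Subtype.ext (h.identDistrib_pastSol t).map_eq

theorem exists_tendstoInDistribution [IsProbabilityMeasure P] (h : IsIndexed P A B m ρ σ) :
    ∃ L : ProbabilityMeasure ℝ≥0∞, TendstoInDistribution
      (fun (t : ℕ) (ω : Ω) => arSol (fun r j => A r j ω) (fun r => B r ω) t)
      atTop (fun x : ℝ≥0∞ => x) (fun _ => P) (L : Measure ℝ≥0∞) := by
  have hT := h.tendstoInDistribution_iSup_pastSol
  let L : ProbabilityMeasure ℝ≥0∞ := ⟨P.map fun ω => ⨆ t, pastSol A B t ω,
    Measure.isProbabilityMeasure_map hT.aemeasurable_limit⟩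
  refine ⟨L, hT.forall_aemeasurable, aemeasurable_id', ?_⟩
  convert hT.tendsto using 2
  exact congrArg 𝓝 (Subtype.ext Measure.map_id')

/-- The moments of the limit law are the limits of the moments of the solution. -/
theorem lintegral_limit [IsProbabilityMeasure P] (h : IsIndexed P A B m ρ σ)
    {L : ProbabilityMeasure ℝ≥0∞} (hL : TendstoInDistribution
      (fun (t : ℕ) (ω : Ω) => arSol (fun r j => A r j ω) (fun r => B r ω) t)
      atTop (fun x : ℝ≥0∞ => x) (fun _ => P) (L : Measure ℝ≥0∞)) {p : ℝ} (hp : 0 < p) :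
    ∫⁻ x, x ^ p ∂(L : Measure ℝ≥0∞)
      = ⨆ t : ℕ, ∫⁻ ω, arSol (fun v j => A v j ω) (fun v => B v ω) t ^ p ∂P := by
  have hT := h.tendstoInDistribution_iSup_pastSol
  have hlaw := tendstoInDistribution_unique _ hL hT
  rw [Measure.map_id'] at hlaw
  rw [hlaw, lintegral_map (by fun_prop) (Measurable.iSup h.measurable_pastSol)]
  simp_rw [iSup_rpow _ hp]
  rw [lintegral_iSup fun t => (h.measurable_pastSol t).pow_const p]
  · refine iSup_congr fun t => ?_
    exact ((h.identDistrib_pastSol t).comp (measurable_id.pow_const p)).lintegral_eq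
  · exact fun s t hst ω => ENNReal.rpow_le_rpow (monotone_pastSol ω hst) hp.le

/-! ### Renewal inequalities for the moments -/

theorem measurable_closedTerm (h : IsIndexed P A B m ρ σ) (t : ℕ) (p : Path × Path) :
    Measurable fun ω => closedTerm (fun v j => A v j ω) (fun v => B v ω) t p := by
  unfold closedTerm
  split_ifs with hd
  · exact ((h.measurable_pathWeight t p.1).coe_nnreal_ennreal.mul
      (h.measurable_pathWeight t p.2).coe_nnreal_ennreal).mul
      ((h.measurable_solution _).pow_const 2)
  · exact measurable_const

theorem measurable_pathTerm (h : IsIndexed P A B m ρ σ) (t : ℕ) (s : Path) :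
    Measurable fun ω => pathTerm (fun v j => A v j ω) (fun v => B v ω) t s := by
  unfold pathTerm
  split_ifs with hd
  · exact (h.measurable_pathWeight t s).coe_nnreal_ennreal.mul
      (h.measurable_noise' _).coe_nnreal_ennreal
  · exact measurable_const

theorem measurable_avoidTerm (h : IsIndexed P A B m ρ σ) (t : ℕ)
    (x : (ℕ+ × Path) × (ℕ+ × Path)) :
    Measurable fun ω => avoidTerm (fun v j => A v j ω) (fun v => B v ω) t x := by
  unfold avoidTerm
  split_ifs with hd
  · exact (h.measurable_pathTerm t _).mul (h.measurable_pathTerm t _)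
  · exact measurable_const

/-- Closed pairs of total weight at least one make the moments of the solution unbounded. -/
theorem iSup_moment_eq_top (h : IsIndexed P A B m ρ σ) {θ : ℝ} (hθ : 0 < θ)
    (hB : ∫⁻ ω, (B 0 ω : ℝ≥0∞) ^ θ ∂P ≠ 0)
    (hS : 1 ≤ ∑' p : closedPairs, pairMoment P A θ p ^ (max 1 (1 / (θ / 2)))) :
    ⨆ t : ℕ, ∫⁻ ω, arSol (fun v j => A v j ω) (fun v => B v ω) t ^ θ ∂P = ∞ := by
  have hq : 0 < θ / 2 := by positivity
  set r := max 1 (1 / (θ / 2)) with hr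
  have hr0 : 0 < r := by positivity
  have hmono := h.monotone_lintegral_arSol hθ.le
  set M : ℕ → ℝ≥0∞ := fun t =>
    ∫⁻ ω, arSol (fun v j => A v j ω) (fun v => B v ω) t ^ θ ∂P with hM
  have key : ⨆ t, M t ^ r = ∞ := by
    refine iSup_eq_top_of_renewal_le (M := fun t => M t ^ r)
      (β := (∫⁻ ω, (B 0 ω : ℝ≥0∞) ^ θ ∂P) ^ r)
      (c := fun p : closedPairs => pairMoment P A θ p ^ r)
      (e := fun p : closedPairs => Path.duration (p : Path × Path).1)
      (by simp [hB, hr0.not_gt]) hS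
      (fun s t hst => ENNReal.rpow_le_rpow (hmono hst) hr0.le) fun t => ?_
    have hclosed : ∀ p : closedPairs,
        (if Path.duration (p : Path × Path).1 ≤ t then
          pairMoment P A θ p ^ r * M (t - Path.duration (p : Path × Path).1) ^ r else 0)
        = (∫⁻ ω, closedTerm (fun v j => A v j ω) (fun v => B v ω) t p ^ (θ / 2) ∂P) ^ r := by
      intro p
      rw [h.lintegral_closedTerm_rpow hθ t p.2]
      simp_rw [sq_rpow_half]
      split_ifs
      · rw [ENNReal.mul_rpow_of_nonneg _ _ hr0.le]
      · rw [ENNReal.zero_rpow_of_pos hr0]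
    simp_rw [hclosed]
    have hb : ∫⁻ ω, (B 0 ω : ℝ≥0∞) ^ θ ∂P = ∫⁻ ω, ((B t ω : ℝ≥0∞) ^ 2) ^ (θ / 2) ∂P := by
      simp_rw [sq_rpow_half]
      exact (h.lintegral_noise θ t).symm
    rw [hb]
    calc _ ≤ (∫⁻ ω, ((B t ω : ℝ≥0∞) ^ 2) ^ (θ / 2) ∂P) ^ r
          + (∫⁻ ω, (∑' p : closedPairs,
            closedTerm (fun v j => A v j ω) (fun v => B v ω) t p) ^ (θ / 2) ∂P) ^ r := by
          gcongr
          exact tsum_lintegral_rpow_le hq fun p => h.measurable_closedTerm t p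
      _ ≤ (∫⁻ ω, ((B t ω : ℝ≥0∞) ^ 2 + ∑' p : closedPairs,
            closedTerm (fun v j => A v j ω) (fun v => B v ω) t p) ^ (θ / 2) ∂P) ^ r :=
          add_lintegral_rpow_max_le hq ((h.measurable_noise' t).coe_nnreal_ennreal.pow_const 2)
      _ ≤ M t ^ r := by
          refine ENNReal.rpow_le_rpow (lintegral_mono fun ω => ?_) hr0.le
          dsimp only
          rw [← sq_rpow_half (arSol _ _ _)]
          gcongr
          exact sq_add_tsum_closedTerm_le _ _ t
  rw [← iSup_rpow _ hr0] at key
  exact (ENNReal.rpow_eq_top_iff_of_pos hr0).1 key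

/-- If the means of the coefficients have sum at least one, the means of the solution are
unbounded. -/
theorem iSup_mean_eq_top (h : IsIndexed P A B m ρ σ) (hB : ∫⁻ ω, (B 0 ω : ℝ≥0∞) ∂P ≠ 0)
    (hS : 1 ≤ ∑' j : ℕ+, ∫⁻ ω, (A 0 j ω : ℝ≥0∞) ∂P) :
    ⨆ t : ℕ, ∫⁻ ω, arSol (fun v j => A v j ω) (fun v => B v ω) t ∂P = ∞ := by
  refine iSup_eq_top_of_renewal_le (β := ∫⁻ ω, (B 0 ω : ℝ≥0∞) ∂P)
    (e := fun j : ℕ+ => (j : ℕ)) hB hS (by simpa using h.monotone_lintegral_arSol zero_le_one)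
    fun t => ?_
  have hterm : ∀ j : ℕ+, (if (j : ℕ) ≤ t then (∫⁻ ω, (A 0 j ω : ℝ≥0∞) ∂P)
        * ∫⁻ ω, arSol (fun v j => A v j ω) (fun v => B v ω) (t - (j : ℕ)) ∂P else 0)
      = ∫⁻ ω, (if (j : ℕ) ≤ t then (A t j ω : ℝ≥0∞)
        * arSol (fun v j => A v j ω) (fun v => B v ω) (t - (j : ℕ)) else 0) ∂P := by
    intro j
    split_ifs with hj
    · rw [h.lintegral_coeff_mul_solution t hj]
    · simp
  have hb := h.lintegral_noise 1 t
  simp only [ENNReal.rpow_one] at hb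
  simp_rw [hterm]
  rw [← hb, ← lintegral_tsum, ← lintegral_add_left (h.measurable_noise' t).coe_nnreal_ennreal]
  · refine lintegral_mono fun ω => ?_
    dsimp only
    conv_rhs => rw [arSol]
    rw [add_comm]
  · intro j
    split_ifs
    · exact ((h.measurable_coeff' t j).coe_nnreal_ennreal.mul
        (h.measurable_solution _)).aemeasurable
    · exact aemeasurable_const

/-- Closed pairs of total weight less than one, together with small moments of order `θ / 2` and
summable mixed moments of the coefficients, keep the moments of the solution bounded. -/
theorem iSup_moment_lt_top [IsProbabilityMeasure P] (h : IsIndexed P A B m ρ σ) {θ : ℝ}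
    (hθ : 0 < θ)
    (hα : ∑' j : ℕ+, (∫⁻ ω, (A 0 j ω : ℝ≥0∞) ^ (θ / 2) ∂P) ^ (min 1 (1 / (θ / 2))) < 1)
    (hS : ∑' p : closedPairs, pairMoment P A θ p ^ (min 1 (1 / (θ / 2))) < 1)
    (hκ : ∑' (i : ℕ+) (j : ℕ+), (if i = j then 0 else
      ∫⁻ ω, (A 0 i ω : ℝ≥0∞) ^ (θ / 2) * (A 0 j ω : ℝ≥0∞) ^ (θ / 2) ∂P)
        ^ (min 1 (1 / (θ / 2))) < ∞)
    (hB : ∫⁻ ω, (B 0 ω : ℝ≥0∞) ^ θ ∂P < ∞) :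
    ⨆ t : ℕ, ∫⁻ ω, arSol (fun v j => A v j ω) (fun v => B v ω) t ^ θ ∂P < ∞ := by
  have hq : 0 < θ / 2 := by positivity
  set q := θ / 2 with hq_def
  set r := min 1 (1 / q) with hr
  have hr0 : 0 < r := by positivity
  set M : ℕ → ℝ≥0∞ := fun t =>
    ∫⁻ ω, arSol (fun v j => A v j ω) (fun v => B v ω) t ^ θ ∂P with hM
  -- the factor `c` absorbs the cross terms between the noise and the rest of the solution
  obtain ⟨c, hc1, hcS⟩ := exists_scale hS (mul_pos hq hr0)
  obtain ⟨C, hC⟩ := exists_add_sq_le hc1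
  have hscale : ∀ (k : ℝ≥0) (Z : Ω → ℝ≥0∞), (∫⁻ ω, ((k : ℝ≥0∞) * Z ω) ^ q ∂P) ^ r
      = (k : ℝ≥0∞) ^ (q * r) * (∫⁻ ω, Z ω ^ q ∂P) ^ r := by
    intro k Z
    simp_rw [ENNReal.mul_rpow_of_nonneg _ _ hq.le]
    rw [lintegral_const_mul' _ _ (by finiteness), ENNReal.mul_rpow_of_nonneg _ _ hr0.le,
      ENNReal.rpow_mul]
  set K : ℝ≥0∞ := ∑' x : (ℕ+ × Path) × (ℕ+ × Path),
    ((if x.1.1 = x.2.1 then 0 else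
        ∫⁻ ω, (A 0 x.1.1 ω : ℝ≥0∞) ^ q * (A 0 x.2.1 ω : ℝ≥0∞) ^ q ∂P) *
      ((x.1.2.map fun j => ∫⁻ ω, (A 0 j ω : ℝ≥0∞) ^ q ∂P).prod
        * ∫⁻ ω, (B 0 ω : ℝ≥0∞) ^ q ∂P) *
      ((x.2.2.map fun j => ∫⁻ ω, (A 0 j ω : ℝ≥0∞) ^ q ∂P).prod
        * ∫⁻ ω, (B 0 ω : ℝ≥0∞) ^ q ∂P)) ^ r with hK
  have hKtop : K < ∞ := tsum_pair_prod_lt_top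
    (fun i j => if i = j then 0 else ∫⁻ ω, (A 0 i ω : ℝ≥0∞) ^ q * (A 0 j ω : ℝ≥0∞) ^ q ∂P)
    (fun j => ∫⁻ ω, (A 0 j ω : ℝ≥0∞) ^ q ∂P) _ hr0.le hκ hα
    (lintegral_rpow_half_lt_top hθ hB).ne
  have key : ⨆ t, M t ^ r < ∞ := by
    refine iSup_lt_top_of_le_renewal (M := fun t => M t ^ r)
      (β := (c : ℝ≥0∞) ^ (q * r) * K
        + (C : ℝ≥0∞) ^ (q * r) * (∫⁻ ω, (B 0 ω : ℝ≥0∞) ^ θ ∂P) ^ r)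
      (c := fun p : closedPairs => (c : ℝ≥0∞) ^ (q * r) * pairMoment P A θ p ^ r)
      (e := fun p : closedPairs => Path.duration (p : Path × Path).1)
      (fun p => closedPairs.duration_pos p.2) ?_ ?_ fun t => ?_
    · have := mul_pos hq hr0
      finiteness
    · rwa [ENNReal.tsum_mul_left]
    have hclosed : ∀ p : closedPairs,
        (if Path.duration (p : Path × Path).1 ≤ t then (c : ℝ≥0∞) ^ (q * r) *
          pairMoment P A θ p ^ r * M (t - Path.duration (p : Path × Path).1) ^ r else 0)
        = (c : ℝ≥0∞) ^ (q * r) *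
          (∫⁻ ω, closedTerm (fun v j => A v j ω) (fun v => B v ω) t p ^ q ∂P) ^ r := by
      intro p
      rw [h.lintegral_closedTerm_rpow hθ t p.2]
      simp_rw [sq_rpow_half]
      split_ifs
      · rw [ENNReal.mul_rpow_of_nonneg _ _ hr0.le, mul_assoc]
      · rw [ENNReal.zero_rpow_of_pos hr0, mul_zero]
    simp_rw [hclosed]
    rw [ENNReal.tsum_mul_left]
    have hb : ∫⁻ ω, (B 0 ω : ℝ≥0∞) ^ θ ∂P = ∫⁻ ω, ((B t ω : ℝ≥0∞) ^ 2) ^ q ∂P := by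
      simp_rw [hq_def, sq_rpow_half]
      exact (h.lintegral_noise θ t).symm
    rw [hb]
    have hmc : Measurable fun ω => ∑' p : closedPairs,
        closedTerm (fun v j => A v j ω) (fun v => B v ω) t p :=
      Measurable.tsum fun p : closedPairs => h.measurable_closedTerm t p
    have hma : Measurable fun ω => ∑' x,
        avoidTerm (fun v j => A v j ω) (fun v => B v ω) t x :=
      Measurable.tsum fun x => h.measurable_avoidTerm t x
    calc M t ^ r
        ≤ (∫⁻ ω, ((c : ℝ≥0∞) * (∑' p : closedPairs,
            closedTerm (fun v j => A v j ω) (fun v => B v ω) t p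
            + ∑' x, avoidTerm (fun v j => A v j ω) (fun v => B v ω) t x)
            + (C : ℝ≥0∞) * (B t ω : ℝ≥0∞) ^ 2) ^ q ∂P) ^ r := by
          refine ENNReal.rpow_le_rpow (lintegral_mono fun ω => ?_) hr0.le
          dsimp only
          rw [← sq_rpow_half (arSol _ _ _)]
          gcongr
          obtain ⟨y, hy, hy2⟩ := exists_arSol_eq_add (fun v j => A v j ω) (fun v => B v ω) t
          rw [hy]
          refine (hC y _).trans ?_
          gcongr
      _ ≤ (c : ℝ≥0∞) ^ (q * r) * (∫⁻ ω, (∑' p : closedPairs,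
            closedTerm (fun v j => A v j ω) (fun v => B v ω) t p
            + ∑' x, avoidTerm (fun v j => A v j ω) (fun v => B v ω) t x) ^ q ∂P) ^ r
          + (C : ℝ≥0∞) ^ (q * r) * (∫⁻ ω, ((B t ω : ℝ≥0∞) ^ 2) ^ q ∂P) ^ r := by
          rw [← hscale, ← hscale]
          exact lintegral_add_rpow_le hq ((hmc.add hma).const_mul _)
            (((h.measurable_noise' t).coe_nnreal_ennreal.pow_const 2).const_mul _)
      _ ≤ (c : ℝ≥0∞) ^ (q * r) * (∑' p : closedPairs,
            (∫⁻ ω, closedTerm (fun v j => A v j ω) (fun v => B v ω) t p ^ q ∂P) ^ r + K)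
          + (C : ℝ≥0∞) ^ (q * r) * (∫⁻ ω, ((B t ω : ℝ≥0∞) ^ 2) ^ q ∂P) ^ r := by
          gcongr
          refine (lintegral_add_rpow_le hq hmc hma).trans (add_le_add ?_ ?_)
          · exact lintegral_tsum_rpow_le hq fun p : closedPairs => h.measurable_closedTerm t p
          · refine (lintegral_tsum_rpow_le hq fun x => h.measurable_avoidTerm t x).trans ?_
            refine ENNReal.tsum_le_tsum fun x => ?_
            exact ENNReal.rpow_le_rpow (h.lintegral_avoidTerm_le hq t x) hr0.le
      _ = _ := by ring
  rw [← iSup_rpow _ hr0] at key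
  exact (ENNReal.rpow_lt_top_iff_of_pos hr0).1 key

end IsIndexed

/-! ### The two models -/

section Models

variable {Ω₀ Ω : Type*} [MeasurableSpace Ω₀] [MeasurableSpace Ω] {P₀ : Measure Ω₀} {P : Measure Ω}
  {A₀ : ℕ+ → Ω₀ → ℝ≥0} {B₀ : Ω₀ → ℝ≥0} {A : ℤ → ℕ+ → Ω → ℝ≥0} {B : ℤ → Ω → ℝ≥0}

theorem identDistrib_coeff
    (hmodel : AssumptionA1 P₀ A₀ B₀ P A B ∨ AssumptionA2 P₀ A₀ B₀ P A B) (j : ℕ+) :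
    IdentDistrib (A 0 j) (A₀ j) P P₀ := by
  rcases hmodel with h | h
  · exact (h.copies 0).comp ((measurable_pi_apply j).comp measurable_fst)
  · obtain ⟨A', hAA', -, hcop⟩ := h.coeff
    rw [show A 0 j = A' (0 - (j : ℕ)) j from funext fun ω => hAA' 0 j ω]
    exact (hcop _).comp (measurable_pi_apply j)

theorem identDistrib_noise
    (hmodel : AssumptionA1 P₀ A₀ B₀ P A B ∨ AssumptionA2 P₀ A₀ B₀ P A B) :
    IdentDistrib (B 0) B₀ P P₀ := by
  rcases hmodel with h | h
  · exact (h.copies 0).comp measurable_snd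
  · exact h.noise_copies 0

theorem lintegral_coeff_rpow_eq
    (hmodel : AssumptionA1 P₀ A₀ B₀ P A B ∨ AssumptionA2 P₀ A₀ B₀ P A B) (q : ℝ) (j : ℕ+) :
    ∫⁻ ω, (A 0 j ω : ℝ≥0∞) ^ q ∂P = ∫⁻ ω, (A₀ j ω : ℝ≥0∞) ^ q ∂P₀ :=
  ((identDistrib_coeff hmodel j).comp
    (measurable_id.coe_nnreal_ennreal.pow_const q)).lintegral_eq

theorem lintegral_noise_rpow_eq
    (hmodel : AssumptionA1 P₀ A₀ B₀ P A B ∨ AssumptionA2 P₀ A₀ B₀ P A B) (q : ℝ) :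
    ∫⁻ ω, (B 0 ω : ℝ≥0∞) ^ q ∂P = ∫⁻ ω, (B₀ ω : ℝ≥0∞) ^ q ∂P₀ :=
  ((identDistrib_noise hmodel).comp
    (measurable_id.coe_nnreal_ennreal.pow_const q)).lintegral_eq

theorem lintegral_noise_rpow_ne_zero [IsProbabilityMeasure P₀] (hB₀ : Measurable B₀)
    (hB_nondeg : P₀ {ω | B₀ ω = 0} < 1) {q : ℝ} (hq : 0 < q) :
    ∫⁻ ω, (B₀ ω : ℝ≥0∞) ^ q ∂P₀ ≠ 0 := by
  intro h0
  rw [lintegral_eq_zero_iff (hB₀.coe_nnreal_ennreal.pow_const q)] at h0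
  have : ∀ᵐ ω ∂P₀, ω ∈ {ω | B₀ ω = 0} := by
    filter_upwards [h0] with ω hω
    simpa [hq, hq.not_gt] using hω
  exact hB_nondeg.ne
    ((prob_compl_eq_zero_iff₀ (hB₀ (measurableSet_singleton 0)).nullMeasurableSet).1 this)

theorem exists_isIndexed [IsProbabilityMeasure P]
    (hA : ∀ t j, Measurable (A t j)) (hB : ∀ t, Measurable (B t))
    (hmodel : AssumptionA1 P₀ A₀ B₀ P A B ∨ AssumptionA2 P₀ A₀ B₀ P A B) :
    ∃ (ι : Type) (m : ι → MeasurableSpace Ω) (ρ : ℤ → ℕ+ → ι) (σ : ℤ → ι),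
      IsIndexed P A B m ρ σ := by
  rcases hmodel with h | h
  · exact ⟨_, _, _, _, isIndexed_of_assumptionA1 hA hB h⟩
  · obtain ⟨m, hm⟩ := exists_isIndexed_of_assumptionA2 hA hB h
    exact ⟨_, m, _, _, hm⟩

/-- The mixed moments of distinct coefficients are summable, by assumption in the first model and
because of independence in the second. -/
theorem tsum_mixed_moment_lt_top [IsProbabilityMeasure P]
    (hA : ∀ t j, Measurable (A t j)) (hB : ∀ t, Measurable (B t)) {θ : ℝ} (hθ : 0 < θ)
    (hα : ∑' j : ℕ+, (∫⁻ ω, (A 0 j ω : ℝ≥0∞) ^ (θ / 2) ∂P) ^ (min 1 (1 / (θ / 2))) < 1)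
    (hmodel : (AssumptionA1 P₀ A₀ B₀ P A B ∧ MixedMomentSummable P₀ A₀ θ) ∨
      AssumptionA2 P₀ A₀ B₀ P A B) :
    ∑' (i : ℕ+) (j : ℕ+), (if i = j then 0 else
      ∫⁻ ω, (A 0 i ω : ℝ≥0∞) ^ (θ / 2) * (A 0 j ω : ℝ≥0∞) ^ (θ / 2) ∂P)
        ^ (min 1 (1 / (θ / 2))) < ∞ := by
  have hr : 0 ≤ min 1 (1 / (θ / 2)) := by positivity
  rcases hmodel with ⟨h, hmix⟩ | h
  · refine lt_of_le_of_lt ?_ hmix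
    rw [one_div_div]
    refine ENNReal.tsum_le_tsum fun i => ENNReal.tsum_le_tsum fun j => ?_
    refine ENNReal.rpow_le_rpow ?_ (by rwa [one_div_div] at hr)
    split_ifs
    · exact zero_le
    · have hm : Measurable fun x : (ℕ+ → ℝ≥0) × ℝ≥0 =>
          (x.1 i : ℝ≥0∞) ^ (θ / 2) * (x.1 j : ℝ≥0∞) ^ (θ / 2) := by fun_prop
      exact (((h.copies 0).comp hm).lintegral_eq).le
  · obtain ⟨m, hm⟩ := exists_isIndexed_of_assumptionA2 hA hB h
    set q := θ / 2
    set r := min 1 (1 / q)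
    calc _ ≤ ∑' (i : ℕ+) (j : ℕ+), (∫⁻ ω, (A 0 i ω : ℝ≥0∞) ^ q ∂P) ^ r
          * (∫⁻ ω, (A 0 j ω : ℝ≥0∞) ^ q ∂P) ^ r := by
          refine ENNReal.tsum_le_tsum fun i => ENNReal.tsum_le_tsum fun j => ?_
          rw [← ENNReal.mul_rpow_of_nonneg _ _ hr]
          refine ENNReal.rpow_le_rpow ?_ hr
          split_ifs with hij
          · exact zero_le
          · refine (hm.lintegral_mul_of_disjoint
              (S := {Sum.inl (0 - ((i : ℕ) : ℤ))}) (T := {Sum.inl (0 - ((j : ℕ) : ℤ))})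
              (by simpa using hij)
              ((hm.coeff_measurable_iSup (Set.mem_singleton _)).coe_nnreal_ennreal.pow_const q)
              ((hm.coeff_measurable_iSup
                (Set.mem_singleton _)).coe_nnreal_ennreal.pow_const q)).le
      _ < ∞ := by
          simp_rw [ENNReal.tsum_mul_left, ENNReal.tsum_mul_right]
          exact ENNReal.mul_lt_top (hα.trans ENNReal.one_lt_top) (hα.trans ENNReal.one_lt_top)

/-- The conditions on the exponent, the coefficients and the closed pairs, in the form that treats
small and large exponents alike. -/
theorem subcritical_of_phi
    (hmodel : AssumptionA1 P₀ A₀ B₀ P A B ∨ AssumptionA2 P₀ A₀ B₀ P A B) {θ : ℝ} (hθ : 0 < θ)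
    (hphi : (θ ≤ 2 ∧ phi₁ P₀ A₀ (θ / 2) < 0 ∧ phi₂ P A θ < 0) ∨
      (2 ≤ θ ∧ phiTilde₁ P₀ A₀ (θ / 2) < 0 ∧ phiTilde₂ P A θ < 0)) :
    ∑' j : ℕ+, (∫⁻ ω, (A 0 j ω : ℝ≥0∞) ^ (θ / 2) ∂P) ^ (min 1 (1 / (θ / 2))) < 1 ∧
      ∑' p : closedPairs, pairMoment P A θ p ^ (min 1 (1 / (θ / 2))) < 1 := by
  simp_rw [lintegral_coeff_rpow_eq hmodel]
  rcases hphi with ⟨h2, h⟩ | ⟨h2, h⟩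
  · rw [min_eq_left ((one_le_div (by positivity)).2 (by linarith))]
    simpa [phi₁, phi₂] using h
  · rw [min_eq_right ((div_le_one (by positivity)).2 (by linarith))]
    simpa [phiTilde₁, phiTilde₂] using h

theorem supercritical_of_phi {θ : ℝ} (hθ : 0 < θ)
    (hphi : (2 ≤ θ ∧ 0 ≤ phi₂ P A θ) ∨ (θ ≤ 2 ∧ 0 ≤ phiTilde₂ P A θ)) :
    1 ≤ ∑' p : closedPairs, pairMoment P A θ p ^ (max 1 (1 / (θ / 2))) := by
  rcases hphi with ⟨h2, h⟩ | ⟨h2, h⟩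
  · rw [max_eq_left ((div_le_one (by positivity)).2 (by linarith))]
    simpa [phi₂] using h
  · rw [max_eq_right ((one_le_div (by positivity)).2 (by linarith))]
    simpa [phiTilde₂] using h

end Models

end

end RandomCoeffAR

theorem theorem2
    {Ω₀ Ω : Type*} [MeasurableSpace Ω₀] [MeasurableSpace Ω]
    (P₀ : Measure Ω₀) [IsProbabilityMeasure P₀] (P : Measure Ω) [IsProbabilityMeasure P]
    (A₀ : ℕ+ → Ω₀ → ℝ≥0) (B₀ : Ω₀ → ℝ≥0)
    (A : ℤ → ℕ+ → Ω → ℝ≥0) (B : ℤ → Ω → ℝ≥0)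
    (hA₀ : ∀ j, Measurable (A₀ j)) (hB₀ : Measurable B₀)
    (hA : ∀ t j, Measurable (A t j)) (hB : ∀ t, Measurable (B t))
    (hB_nondeg : P₀ {ω | B₀ ω = 0} < 1)
    (hmodel : RandomCoeffAR.AssumptionA1 P₀ A₀ B₀ P A B ∨
      RandomCoeffAR.AssumptionA2 P₀ A₀ B₀ P A B) :
    -- the solution started from zero converges in law in `[0, ∞]` ...
    (∃ L : ProbabilityMeasure ℝ≥0∞, TendstoInDistribution
      (fun (t : ℕ) (ω : Ω) => RandomCoeffAR.arSol (fun r j => A r j ω) (fun r => B r ω) t)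
      atTop (fun x : ℝ≥0∞ => x) (fun _ => P) (L : Measure ℝ≥0∞)) ∧
    -- ... and `L` being the law of the limit `X`:
    ∀ L : ProbabilityMeasure ℝ≥0∞, TendstoInDistribution
      (fun (t : ℕ) (ω : Ω) => RandomCoeffAR.arSol (fun r j => A r j ω) (fun r => B r ω) t)
      atTop (fun x : ℝ≥0∞ => x) (fun _ => P) (L : Measure ℝ≥0∞) →
    -- criterion for an infinite moment
    (∀ θ : ℝ, 0 < θ →
      ((2 ≤ θ ∧ 0 ≤ RandomCoeffAR.phi₂ P A θ) ∨ (θ ≤ 2 ∧ 0 ≤ RandomCoeffAR.phiTilde₂ P A θ)) →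
      ∫⁻ x, x ^ θ ∂(L : Measure ℝ≥0∞) = ∞) ∧
    -- criterion for a finite moment
    (∀ θ : ℝ, 0 < θ →
      ((θ ≤ 2 ∧ RandomCoeffAR.phi₁ P₀ A₀ (θ / 2) < 0 ∧ RandomCoeffAR.phi₂ P A θ < 0) ∨
        (2 ≤ θ ∧ RandomCoeffAR.phiTilde₁ P₀ A₀ (θ / 2) < 0 ∧
          RandomCoeffAR.phiTilde₂ P A θ < 0)) →
      ((RandomCoeffAR.AssumptionA1 P₀ A₀ B₀ P A B ∧
          RandomCoeffAR.MixedMomentSummable P₀ A₀ θ) ∨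
        RandomCoeffAR.AssumptionA2 P₀ A₀ B₀ P A B) →
      ∫⁻ ω, (B₀ ω : ℝ≥0∞) ^ θ ∂P₀ < ∞ →
      ∫⁻ x, x ^ θ ∂(L : Measure ℝ≥0∞) < ∞) ∧
    -- the necessary and sufficient criterion for second moments
    (((RandomCoeffAR.AssumptionA1 P₀ A₀ B₀ P A B ∧
          RandomCoeffAR.MixedMomentSummable P₀ A₀ 2) ∨
        RandomCoeffAR.AssumptionA2 P₀ A₀ B₀ P A B) →
      ∫⁻ ω, (B₀ ω : ℝ≥0∞) ^ (2 : ℝ) ∂P₀ < ∞ →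
      (∫⁻ x, x ^ (2 : ℝ) ∂(L : Measure ℝ≥0∞) < ∞ ↔
        RandomCoeffAR.phi₁ P₀ A₀ 1 < 0 ∧ RandomCoeffAR.phi₂ P A 2 < 0)) := by
  obtain ⟨ι, m, ρ, σ, h⟩ := RandomCoeffAR.exists_isIndexed hA hB hmodel
  refine ⟨h.exists_tendstoInDistribution, fun L hL => ?_⟩
  have infinite : ∀ θ : ℝ, 0 < θ →
      ((2 ≤ θ ∧ 0 ≤ RandomCoeffAR.phi₂ P A θ) ∨ (θ ≤ 2 ∧ 0 ≤ RandomCoeffAR.phiTilde₂ P A θ)) →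
      ∫⁻ x, x ^ θ ∂(L : Measure ℝ≥0∞) = ∞ := by
    intro θ hθ hphi
    rw [h.lintegral_limit hL hθ]
    refine h.iSup_moment_eq_top hθ ?_ (RandomCoeffAR.supercritical_of_phi hθ hphi)
    rw [RandomCoeffAR.lintegral_noise_rpow_eq hmodel]
    exact RandomCoeffAR.lintegral_noise_rpow_ne_zero hB₀ hB_nondeg hθ
  have finite : ∀ θ : ℝ, 0 < θ →
      ((θ ≤ 2 ∧ RandomCoeffAR.phi₁ P₀ A₀ (θ / 2) < 0 ∧ RandomCoeffAR.phi₂ P A θ < 0) ∨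
        (2 ≤ θ ∧ RandomCoeffAR.phiTilde₁ P₀ A₀ (θ / 2) < 0 ∧
          RandomCoeffAR.phiTilde₂ P A θ < 0)) →
      ((RandomCoeffAR.AssumptionA1 P₀ A₀ B₀ P A B ∧
          RandomCoeffAR.MixedMomentSummable P₀ A₀ θ) ∨
        RandomCoeffAR.AssumptionA2 P₀ A₀ B₀ P A B) →
      ∫⁻ ω, (B₀ ω : ℝ≥0∞) ^ θ ∂P₀ < ∞ →
      ∫⁻ x, x ^ θ ∂(L : Measure ℝ≥0∞) < ∞ := by
    intro θ hθ hphi hmix hBθ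
    obtain ⟨hα, hS⟩ := RandomCoeffAR.subcritical_of_phi hmodel hθ hphi
    rw [h.lintegral_limit hL hθ]
    exact h.iSup_moment_lt_top hθ hα hS
      (RandomCoeffAR.tsum_mixed_moment_lt_top hA hB hθ hα hmix)
      (by rwa [RandomCoeffAR.lintegral_noise_rpow_eq hmodel])
  refine ⟨infinite, finite, fun hmix hB2 => ⟨fun hfin => ⟨?_, ?_⟩, fun hphi => ?_⟩⟩
  -- a finite second moment entails a finite mean, which bounds the sum of the means of the
  -- coefficients
  · by_contra hcon
    have hmean : 1 ≤ ∑' j : ℕ+, ∫⁻ ω, (A 0 j ω : ℝ≥0∞) ∂P := by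
      have e := RandomCoeffAR.lintegral_coeff_rpow_eq hmodel 1
      simp only [ENNReal.rpow_one] at e
      simpa [RandomCoeffAR.phi₁, e] using hcon
    have hB1 : ∫⁻ ω, (B 0 ω : ℝ≥0∞) ∂P ≠ 0 := by
      have e := RandomCoeffAR.lintegral_noise_rpow_eq hmodel 1
      have e' := RandomCoeffAR.lintegral_noise_rpow_ne_zero hB₀ hB_nondeg one_pos
      rw [← e] at e'
      simpa using e'
    have htop := h.iSup_mean_eq_top hB1 hmean
    have hlim := h.lintegral_limit hL one_pos
    simp only [ENNReal.rpow_one] at hlim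
    have hfirst := RandomCoeffAR.lintegral_rpow_half_lt_top two_pos hfin
    simp only [div_self (two_ne_zero' ℝ), ENNReal.rpow_one] at hfirst
    rw [hlim, htop] at hfirst
    exact lt_irrefl _ hfirst
  · by_contra hcon
    exact hfin.ne (infinite 2 two_pos (Or.inl ⟨le_rfl, not_lt.1 hcon⟩))
  · exact finite 2 two_pos (Or.inl ⟨le_rfl, by simpa using hphi.1, hphi.2⟩) hmix hB2
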